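/- **Definitions.** Let $A\in\mathbb Z^{d\times n}$. For each of the $2^n$ closed orthants $\mathbb O_j$ of $\mathbb R^n$, let $C_j=\ker(A)\cap\mathbb O_j$, and let $R_j$ and $H_j$ be the minimal sets of primitive integer vectors (vectors with coprime components) that generate $C_j$ over $\mathbb R_+$ and $C_j\cap\mathbb Z^n$ over $\mathbb Z_+$, respectively. The set of circuits of $A$ is $\mathcal C(A)=\bigcup_j R_j\setminus\{0\}$ and the Graver basis of $A$ is $\mathcal G(A)=\bigcup_j H_j\setminus\{0\}$. For a feasible set $\mathcal F\subseteq\mathbb R^n$, a point $z\in\mathcal F$, an objective $f:\mathbb R^n\to\mathbb R$ and a set $S\subseteq\mathbb R^n$ of directions, a *greedy augmentation vector* from $S$ for $z$ is a vector $\alpha g$, where $(\alpha,g)$ is an optimal solution of $\min\{f(z+\alpha g):\alpha\in\mathbb R_+,\ g\in S,\ z+\alpha g\in\mathcal F\}$. Write $\operatorname{supp}(z)=\{i:z_i\neq0\}$. Encoding lengths are binary. **Theorem.** Let $A\in\mathbb Z^{d\times n}$, $u\in\mathbb Q^n$, $b\in\mathbb Z^d$, $c\in\mathbb Q^n$ and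 $f(z)=c^\intercal z$. Consider $$(\mathrm{LP})\ \min\{c^\intercal z: Az=b,\ 0\le z\le u,\ z\in\mathbb R^n\},\qquad (\mathrm{IP})\ \min\{c^\intercal z: Az=b,\ 0\le z\le u,\ z\in\mathbb Z^n\}.$$ (a) Any feasible solution $z^0\in\mathbb Q^n$ of (LP) is augmented to an optimal solution of (LP) by the following procedure, started with $z:=z^0$, however its choices are made. 1. If no feasible $z+\alpha g$ with $g\in\mathcal C(A)$, $\alpha\in\mathbb R_+$ has a smaller objective value than $z$ (so that the greedy step may be taken to be $0$), return $z$ as optimal solution. Otherwise choose a greedy augmentation vector $\alpha g$ from $\mathcal C(A)$ for $z$ and set $z:=z+\alpha g$. 2. As long as it is possible, find $g\in\mathcal C(A)$ and $\alpha>0$ such that $z+\alpha g$ is feasible, $c^\intercal(z+\alpha g)\le c^\intercal z$, and the step reduces the support with respect to the bounds $0\le z\le u$, that is, either $\operatorname{supp}(z+\alpha g)\subsetneq\operatorname{supp}(z)$, or $\operatorname{supp}(z+\alpha g)=\operatorname{supp}(z)$ and $\operatorname{supp}(u-z-\alpha g)\subsetneq\operatorname{supp}(u-z)$; set $z:=z+\alpha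 g$. When no such step is possible, go back to Step 1. The procedure always terminates, and the total number of its augmentation steps (those of Step 1 and those of Step 2) is bounded by a fixed polynomial in the encoding lengths of $A$, $u$, $b$, $c$ and $z^0$. (b) Any feasible solution $z^0$ of (IP) is augmented to an optimal solution of (IP) by the following procedure, started with $z:=z^0$, however its choices are made: if no feasible $z+\alpha g$ with $g\in\mathcal G(A)$, $\alpha\in\mathbb R_+$ has a smaller objective value than $z$, return $z$ as optimal solution; otherwise choose a greedy augmentation vector $\alpha g$ from $\mathcal G(A)$ for $z$, set $z:=z+\alpha g$, and repeat. The procedure always terminates, and the number of augmentation steps is bounded by a fixed polynomial in the encoding lengths of $A$, $u$, $b$, $c$ and $z^0$. -/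

import Mathlib

open scoped NNReal

namespace GreedyAugmentation

/-! ### Circuits and Graver basis of an integer matrix -/

/-- An integer vector is primitive if its components are coprime. -/
def IsPrimitiveVec {n : ℕ} (v : Fin n → ℤ) : Prop :=
  Finset.univ.gcd v = 1

/-- An integer vector regarded as a real vector. -/
def toReal {n : ℕ} (v : Fin n → ℤ) : Fin n → ℝ := fun i => (v i : ℝ)

/-- The cone `ker A ∩ O_s` in `ℝⁿ`, where the sign vector `s` (an element of `{1, -1}ⁿ`) stands for
the closed orthant `O_s = {z : s i * z i ≥ 0 for all i}`. -/
def orthantCone {d n : ℕ} (A : Matrix (Fin d) (Fin n) ℤ) (s : Fin n → ℤˣ) : Set (Fin n → ℝ) :=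
  {z | (A.map (fun a : ℤ => (a : ℝ))).mulVec z = 0 ∧ ∀ i, 0 ≤ (((s i : ℤˣ) : ℤ) : ℝ) * z i}

/-- The lattice points `ker A ∩ O_s ∩ ℤⁿ`. -/
def orthantLattice {d n : ℕ} (A : Matrix (Fin d) (Fin n) ℤ) (s : Fin n → ℤˣ) : Set (Fin n → ℤ) :=
  {z | A.mulVec z = 0 ∧ ∀ i, 0 ≤ ((s i : ℤˣ) : ℤ) * z i}

/-- `R` is a set of primitive integer vectors that generates `ker A ∩ O_s` over `ℝ₊`. -/
def GeneratesCone {d n : ℕ} (A : Matrix (Fin d) (Fin n) ℤ) (s : Fin n → ℤˣ)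
    (R : Set (Fin n → ℤ)) : Prop :=
  (∀ v ∈ R, IsPrimitiveVec v) ∧
    (Submodule.span ℝ≥0 (toReal '' R) : Set (Fin n → ℝ)) = orthantCone A s

/-- `H` is a set of primitive integer vectors that generates `ker A ∩ O_s ∩ ℤⁿ` over `ℤ₊`. -/
def GeneratesLattice {d n : ℕ} (A : Matrix (Fin d) (Fin n) ℤ) (s : Fin n → ℤˣ)
    (H : Set (Fin n → ℤ)) : Prop :=
  (∀ v ∈ H, IsPrimitiveVec v) ∧
    (AddSubmonoid.closure H : Set (Fin n → ℤ)) = orthantLattice A s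

/-- The circuits of `A`: the nonzero elements of the minimal generating sets of the cones
`ker A ∩ O_s`, over all orthants. -/
def circuits {d n : ℕ} (A : Matrix (Fin d) (Fin n) ℤ) : Set (Fin n → ℤ) :=
  {g | g ≠ 0 ∧ ∃ (s : Fin n → ℤˣ) (R : Set (Fin n → ℤ)), Minimal (GeneratesCone A s) R ∧ g ∈ R}

/-- The Graver basis of `A`: the nonzero elements of the minimal generating sets of the monoids
`ker A ∩ O_s ∩ ℤⁿ`, over all orthants. -/
def graverBasis {d n : ℕ} (A : Matrix (Fin d) (Fin n) ℤ) : Set (Fin n → ℤ) :=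
  {g | g ≠ 0 ∧ ∃ (s : Fin n → ℤˣ) (H : Set (Fin n → ℤ)),
    Minimal (GeneratesLattice A s) H ∧ g ∈ H}

/-! ### The linear and the integer program -/

/-- Feasible set of the linear program: `A z = b`, `0 ≤ z ≤ u`, `z` real. -/
def lpFeasible {d n : ℕ} (A : Matrix (Fin d) (Fin n) ℤ) (u : Fin n → ℚ) (b : Fin d → ℤ) :
    Set (Fin n → ℝ) :=
  {z | (A.map (fun a : ℤ => (a : ℝ))).mulVec z = (fun j => (b j : ℝ)) ∧
    ∀ i, 0 ≤ z i ∧ z i ≤ (u i : ℝ)}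

/-- Feasible set of the integer program: `A z = b`, `0 ≤ z ≤ u`, `z` integral. -/
def ipFeasible {d n : ℕ} (A : Matrix (Fin d) (Fin n) ℤ) (u : Fin n → ℚ) (b : Fin d → ℤ) :
    Set (Fin n → ℝ) :=
  {z | z ∈ lpFeasible A u b ∧ ∀ i, ∃ k : ℤ, z i = (k : ℝ)}

/-- The linear objective `cᵀ z`. -/
def objective {n : ℕ} (c : Fin n → ℚ) (z : Fin n → ℝ) : ℝ := ∑ i, (c i : ℝ) * z i

/-- `z` minimizes `f` over the feasible set `F`. -/
def IsOptimal {n : ℕ} (F : Set (Fin n → ℝ)) (f : (Fin n → ℝ) → ℝ) (z : Fin n → ℝ) : Prop :=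
  z ∈ F ∧ ∀ y ∈ F, f z ≤ f y

/-! ### Greedy augmentation -/

/-- `v` is a greedy augmentation vector from the set of directions `S` for `z`: `v = α g` for an
optimal solution `(α, g)` of `min {f (z + α g) : α ∈ ℝ₊, g ∈ S, z + α g ∈ F}`. -/
def IsGreedy {n : ℕ} (F : Set (Fin n → ℝ)) (f : (Fin n → ℝ) → ℝ) (S : Set (Fin n → ℝ))
    (z v : Fin n → ℝ) : Prop :=
  (∃ α : ℝ, 0 ≤ α ∧ ∃ g ∈ S, v = α • g) ∧ z + v ∈ F ∧
    ∀ α : ℝ, 0 ≤ α → ∀ g ∈ S, z + α • g ∈ F → f (z + v) ≤ f (z + α • g)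

/-- No step along a direction from `S` improves `z`, so the greedy step is `0`. -/
def NoImprovement {n : ℕ} (F : Set (Fin n → ℝ)) (f : (Fin n → ℝ) → ℝ) (S : Set (Fin n → ℝ))
    (z : Fin n → ℝ) : Prop :=
  ∀ α : ℝ, 0 ≤ α → ∀ g ∈ S, z + α • g ∈ F → f z ≤ f (z + α • g)

/-- The states of the procedures, with the current solution: about to make a greedy step, within
the support-reducing phase, or stopped and having returned the current solution. -/
inductive State (n : ℕ) : Type
  | greedy (z : Fin n → ℝ)
  | reduce (z : Fin n → ℝ)
  | returned (z : Fin n → ℝ)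

/-- The passage from `z` to `y` reduces the support with respect to the bounds `0 ≤ z ≤ u`: either
the support of `z` shrinks, or it stays the same and the support of the vector `u - z` of upper
slacks shrinks. -/
def SupportReducing {n : ℕ} (u : Fin n → ℚ) (z y : Fin n → ℝ) : Prop :=
  Function.support y ⊂ Function.support z ∨
    (Function.support y = Function.support z ∧
      (Function.support fun i => (u i : ℝ) - y i) ⊂ Function.support fun i => (u i : ℝ) - z i)

/-- A support-reducing circuit step from `z` to `y`. -/
def CircuitStep {d n : ℕ} (A : Matrix (Fin d) (Fin n) ℤ) (u : Fin n → ℚ) (b : Fin d → ℤ)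
    (c : Fin n → ℚ) (z y : Fin n → ℝ) : Prop :=
  (∃ g ∈ circuits A, ∃ α : ℝ, 0 < α ∧ y = z + α • toReal g) ∧
    y ∈ lpFeasible A u b ∧ objective c y ≤ objective c z ∧ SupportReducing u z y

/-- The transitions of the greedy procedure for the linear program; the number is the number of
augmentation steps (`1` for a greedy or a circuit step, `0` for a change of phase). -/
inductive LPStep {d n : ℕ} (A : Matrix (Fin d) (Fin n) ℤ) (u : Fin n → ℚ) (b : Fin d → ℤ)
    (c : Fin n → ℚ) : State n → ℕ → State n → Prop
  | augment (z v : Fin n → ℝ)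
      (greedy : IsGreedy (lpFeasible A u b) (objective c) (toReal '' circuits A) z v)
      (improving : objective c (z + v) < objective c z) :
      LPStep A u b c (.greedy z) 1 (.reduce (z + v))
  | finish (z : Fin n → ℝ)
      (noImprovement : NoImprovement (lpFeasible A u b) (objective c) (toReal '' circuits A) z) :
      LPStep A u b c (.greedy z) 0 (.returned z)
  | reduce (z y : Fin n → ℝ) (circuit : CircuitStep A u b c z y) :
      LPStep A u b c (.reduce z) 1 (.reduce y)
  | back (z : Fin n → ℝ) (irreducible : ∀ y, ¬ CircuitStep A u b c z y) :
      LPStep A u b c (.reduce z) 0 (.greedy z)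

/-- The transitions of the greedy procedure for the integer program. -/
inductive IPStep {d n : ℕ} (A : Matrix (Fin d) (Fin n) ℤ) (u : Fin n → ℚ) (b : Fin d → ℤ)
    (c : Fin n → ℚ) : State n → ℕ → State n → Prop
  | augment (z v : Fin n → ℝ)
      (greedy : IsGreedy (ipFeasible A u b) (objective c) (toReal '' graverBasis A) z v)
      (improving : objective c (z + v) < objective c z) :
      IPStep A u b c (.greedy z) 1 (.greedy (z + v))
  | finish (z : Fin n → ℝ)
      (noImprovement : NoImprovement (ipFeasible A u b) (objective c) (toReal '' graverBasis A) z) :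
      IPStep A u b c (.greedy z) 0 (.returned z)

/-- `Run step σ k τ`: the procedure can get from `σ` to `τ` with `k` augmentation steps. -/
inductive Run {σ : Type} (step : σ → ℕ → σ → Prop) (start : σ) : ℕ → σ → Prop
  | refl : Run step start 0 start
  | snoc {k w : ℕ} {s t : σ} : Run step start k s → step s w t → Run step start (k + w) t

/-- However its choices are made, the procedure `step` started at `z₀` makes at most `N`
augmentation steps, does not go on forever, is never stuck before it returns a solution, and
returns only optimal solutions of `min {f z : z ∈ F}`. -/
def SolvesWithin {n : ℕ} (step : State n → ℕ → State n → Prop) (F : Set (Fin n → ℝ))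
    (f : (Fin n → ℝ) → ℝ) (z₀ : Fin n → ℝ) (N : ℕ) : Prop :=
  (∀ k s, Run step (.greedy z₀) k s → k ≤ N) ∧
  (¬ ∃ (s : ℕ → State n) (w : ℕ → ℕ), s 0 = .greedy z₀ ∧ ∀ i, step (s i) (w i) (s (i + 1))) ∧
  (∀ k s, Run step (.greedy z₀) k s → (∃ w t, step s w t) ∨ ∃ z, s = .returned z) ∧
  (∀ k z, Run step (.greedy z₀) k (.returned z) → IsOptimal F f z)

/-! ### Encoding lengths -/

/-- Binary encoding length `1 + ⌈log₂ (|a| + 1)⌉` of an integer. -/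
def intLength (a : ℤ) : ℕ := 1 + Nat.clog 2 (a.natAbs + 1)

/-- Binary encoding length of a rational number: that of its reduced numerator and denominator. -/
def ratLength (q : ℚ) : ℕ := intLength q.num + intLength (q.den : ℤ)

/-- The total encoding length of `A`, `u`, `b`, `c` and `z₀`. -/
def inputLength {d n : ℕ} (A : Matrix (Fin d) (Fin n) ℤ) (u : Fin n → ℚ) (b : Fin d → ℤ)
    (c z₀ : Fin n → ℚ) : ℕ :=
  (∑ j, ∑ i, intLength (A j i)) + (∑ i, ratLength (u i)) + (∑ j, intLength (b j)) +
    (∑ i, ratLength (c i)) + ∑ i, ratLength (z₀ i)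

end GreedyAugmentation

/-! The difference `y - z` of two feasible points is a sum of nonnegative multiples of circuits (of
Graver elements in the integer case) lying in one orthant. No cancellation occurs in such a sum, so
each summand by itself is a feasible step from `z`. With at most `N` summands the best one gains an
`N`-th of the distance to `f y`, and the greedy step gains no less. Hence the optimality gap shrinks
by a factor `1 - 1 / (N + 1)` per greedy step (`HasGoodSteps`, `IsGreedy.sub_le`). For circuits `N =
n` works. For Graver elements a pigeonhole argument on subset sums gives `N ≤ log₂ ∏ (|xᵢ| + 1)` for
`x = y - z` (`exists_short_decomposition`), which the encoding length of `u` bounds.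

Geometric decay means polynomially many steps once the initial gap is at most `2 ^ Q` and every
nonzero gap at least `2 ^ (-P)`, with `P` and `Q` polynomial (`le_of_geometric_decay`). For integer
points the denominators of `c` give `P`. In the linear program no such bound holds at arbitrary
points, which is what the support reduction repairs: it can only stop at a vertex, and Cramer's rule
bounds the denominators there. One reduction phase is short because `supportMeasure` drops with
every step.

Vertices enter through the integer matrix `restrictedGram A S`, with `S` the coordinates strictly
between their bounds. If it is singular, a kernel vector supported in `S` yields a reducing circuit
step (`exists_circuitStep`). If it is nonsingular, its determinant controls the denominators
(`det_mul_prod_den_mul_mem`). -/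

namespace GreedyAugmentation

/-! ### Kernel vectors with prescribed support. -/

variable {d n : ℕ}

/-- The matrix `AᵀA + diag(1 outside S)`: it is singular exactly when `ker A` contains a nonzero
vector supported in `S`. -/
noncomputable def restrictedGram (A : Matrix (Fin d) (Fin n) ℤ) (S : Set (Fin n)) :
    Matrix (Fin n) (Fin n) ℤ :=
  A.transpose * A + Matrix.diagonal (Sᶜ.indicator 1)

lemma map_mulVec_toReal (A : Matrix (Fin d) (Fin n) ℤ) (w : Fin n → ℤ) :
    (A.map (fun a : ℤ => (a : ℝ))).mulVec (toReal w) = toReal (A.mulVec w) := by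
  ext j
  simp [Matrix.mulVec, dotProduct, toReal]

lemma toReal_eq_zero {w : Fin n → ℤ} : toReal w = 0 ↔ w = 0 := by
  simp [funext_iff, toReal]

lemma map_mulVec_toReal_eq_zero {A : Matrix (Fin d) (Fin n) ℤ} {w : Fin n → ℤ} :
    (A.map (fun a : ℤ => (a : ℝ))).mulVec (toReal w) = 0 ↔ A.mulVec w = 0 := by
  rw [map_mulVec_toReal, toReal_eq_zero]

lemma restrictedGram_map_mulVec (A : Matrix (Fin d) (Fin n) ℤ) (S : Set (Fin n))
    (y : Fin n → ℝ) :
    ((restrictedGram A S).map (fun a : ℤ => (a : ℝ))).mulVec y =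
      (A.map (fun a : ℤ => (a : ℝ))).transpose.mulVec
        ((A.map (fun a : ℤ => (a : ℝ))).mulVec y) + Sᶜ.indicator y := by
  classical
  have h : (restrictedGram A S).map (fun a : ℤ => (a : ℝ)) =
      (A.map (fun a : ℤ => (a : ℝ))).transpose * (A.map (fun a : ℤ => (a : ℝ))) +
        Matrix.diagonal (Sᶜ.indicator 1) := by
    ext i j
    by_cases hij : i = j
    · subst hij
      by_cases hi : i ∈ S <;> simp [restrictedGram, Matrix.mul_apply, hi]
    · simp [restrictedGram, Matrix.mul_apply, hij]
  rw [h, Matrix.add_mulVec, Matrix.mulVec_mulVec]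
  congr 1
  ext i
  by_cases hi : i ∈ S <;> simp [Matrix.mulVec_diagonal, hi]

/-- The quadratic form of the matrix at `w` is `|Aw|²` plus the sum of `wᵢ²` over `i ∉ S`. At a null
vector both nonnegative parts vanish. -/
lemma exists_kernel_of_det_restrictedGram_eq_zero {A : Matrix (Fin d) (Fin n) ℤ}
    {S : Set (Fin n)} (h : (restrictedGram A S).det = 0) :
    ∃ w : Fin n → ℤ, w ≠ 0 ∧ A.mulVec w = 0 ∧ ∀ i, i ∉ S → w i = 0 := by
  classical
  obtain ⟨w, hw, hMw⟩ := Matrix.exists_mulVec_eq_zero_iff.2 h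
  have key : A.mulVec w ⬝ᵥ A.mulVec w + w ⬝ᵥ Sᶜ.indicator w = 0 := by
    have e : w ⬝ᵥ (restrictedGram A S).mulVec w = 0 := by rw [hMw]; simp
    rw [restrictedGram, Matrix.add_mulVec, dotProduct_add, ← Matrix.mulVec_mulVec,
      Matrix.dotProduct_mulVec, Matrix.vecMul_transpose] at e
    rw [← e]
    congr 2
    ext i
    by_cases hi : i ∈ S <;> simp [Matrix.mulVec_diagonal, hi]
  have h1 : 0 ≤ A.mulVec w ⬝ᵥ A.mulVec w :=
    Finset.sum_nonneg fun i _ => mul_self_nonneg _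
  have h2' : ∀ i, 0 ≤ w i * Sᶜ.indicator w i := fun i => by
    by_cases hi : i ∈ S <;> simp [hi, mul_self_nonneg]
  have h2 : 0 ≤ w ⬝ᵥ Sᶜ.indicator w := Finset.sum_nonneg fun i _ => h2' i
  refine ⟨w, hw, dotProduct_self_eq_zero.1 (by linarith), fun i hi => ?_⟩
  have h3 : w ⬝ᵥ Sᶜ.indicator w = 0 := by linarith
  have := (Finset.sum_eq_zero_iff_of_nonneg fun i _ => h2' i).1 h3 i (Finset.mem_univ i)
  simpa [hi] using this

lemma det_map_smul_eq_zero {M : Matrix (Fin n) (Fin n) ℤ} {y : Fin n → ℝ}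
    (h : (M.map (fun a : ℤ => (a : ℝ))).mulVec y = 0) (hy : y ≠ 0) : M.det = 0 := by
  have h1 : (M.map (fun a : ℤ => (a : ℝ))).det = 0 :=
    Matrix.exists_mulVec_eq_zero_iff.1 ⟨y, hy, h⟩
  have h2 : ((M.det : ℤ) : ℝ) = (M.map (fun a : ℤ => (a : ℝ))).det :=
    RingHom.map_det (Int.castRingHom ℝ) M
  exact_mod_cast h2.trans h1

/-- Singularity of an integer matrix does not depend on the field, so a real kernel vector can be
traded for an integer one without enlarging the support. -/
lemma exists_int_kernel {A : Matrix (Fin d) (Fin n) ℤ} {y : Fin n → ℝ}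
    (hA : (A.map (fun a : ℤ => (a : ℝ))).mulVec y = 0) (hy : y ≠ 0) :
    ∃ w : Fin n → ℤ, w ≠ 0 ∧ A.mulVec w = 0 ∧ ∀ i, y i = 0 → w i = 0 := by
  obtain ⟨w, h1, h2, h3⟩ := exists_kernel_of_det_restrictedGram_eq_zero (A := A)
    (S := Function.support y) (det_map_smul_eq_zero (y := y) (by
      rw [restrictedGram_map_mulVec, hA]
      ext i
      by_cases hi : y i = 0 <;> simp [hi]) hy)
  exact ⟨w, h1, h2, fun i hi => h3 i (by simpa using hi)⟩

/-! ### Primitive vectors -/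

lemma IsPrimitiveVec.ne_zero {v : Fin n → ℤ} (h : IsPrimitiveVec v) : v ≠ 0 := by
  rintro rfl
  have : Finset.univ.gcd (0 : Fin n → ℤ) = 0 := Finset.gcd_eq_zero_iff.2 (by simp)
  rw [IsPrimitiveVec, this] at h
  exact zero_ne_one h

lemma IsPrimitiveVec.neg {v : Fin n → ℤ} (h : IsPrimitiveVec v) : IsPrimitiveVec (-v) := by
  have : Finset.univ.gcd (fun i => (-1) * v i) = normalize (-1) * Finset.univ.gcd v :=
    Finset.gcd_mul_left
  unfold IsPrimitiveVec at *
  rw [h] at this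
  rw [show (-v) = fun i => (-1) * v i by ext; simp, this, Int.normalize_of_nonpos (by simp)]
  simp

lemma exists_primitive {w : Fin n → ℤ} (hw : w ≠ 0) :
    ∃ (k : ℤ) (v : Fin n → ℤ), 0 < k ∧ IsPrimitiveVec v ∧ w = k • v := by
  obtain ⟨i, hi⟩ := Function.ne_iff.1 hw
  obtain ⟨v, h1, h2⟩ := Finset.extract_gcd w (s := Finset.univ) ⟨i, Finset.mem_univ i⟩
  refine ⟨Finset.univ.gcd w, v, ?_, h2, funext fun j => by simpa using h1 j (Finset.mem_univ j)⟩
  refine lt_of_le_of_ne ?_ fun h => hi ?_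
  · exact Int.nonneg_of_normalize_eq_self Finset.normalize_gcd
  · exact Finset.gcd_eq_zero_iff.1 h.symm i (Finset.mem_univ i)

lemma IsPrimitiveVec.eq_of_smul_eq {v w : Fin n → ℤ} (hv : IsPrimitiveVec v)
    (hw : IsPrimitiveVec w) {a b : ℤ} (ha : 0 < a) (hb : 0 < b) (h : a • v = b • w) : v = w := by
  have e (k : ℤ) (hk : 0 < k) (x : Fin n → ℤ) (hx : IsPrimitiveVec x) :
      Finset.univ.gcd (k • x) = k := by
    have : Finset.univ.gcd (fun i => k * x i) = normalize k * Finset.univ.gcd x :=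
      Finset.gcd_mul_left
    rw [show k • x = fun i => k * x i from rfl, this, hx, Int.normalize_of_nonneg hk.le, mul_one]
  have hab : a = b := by rw [← e a ha v hv, h, e b hb w hw]
  subst hab
  exact smul_right_injective _ ha.ne' h

/-! ### Elementary vectors -/

/-- A primitive integer vector in the kernel of `A` whose support is minimal among the supports of
nonzero integer vectors in the kernel. -/
def IsElementary (A : Matrix (Fin d) (Fin n) ℤ) (g : Fin n → ℤ) : Prop :=
  IsPrimitiveVec g ∧ A.mulVec g = 0 ∧
    ∀ w : Fin n → ℤ, w ≠ 0 → A.mulVec w = 0 → (∀ i, g i = 0 → w i = 0) → ∀ i, w i = 0 → g i = 0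

lemma IsElementary.neg {A : Matrix (Fin d) (Fin n) ℤ} {g : Fin n → ℤ} (h : IsElementary A g) :
    IsElementary A (-g) :=
  ⟨h.1.neg, by rw [Matrix.mulVec_neg, h.2.1, neg_zero], fun w h0 h1 h2 i hi => by
    simpa using h.2.2 w h0 h1 (fun j hj => h2 j (by simpa using hj)) i hi⟩

/-- The kernel vector `g j • r - r j • g` vanishes at `j`, where `g` does not, so minimality of the
support of `g` makes it zero. Proportional primitive vectors agree up to sign, and `hj` fixes the
sign. -/
lemma IsElementary.eq_of_support_subset {A : Matrix (Fin d) (Fin n) ℤ} {g r : Fin n → ℤ}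
    (hg : IsElementary A g) (hr : IsPrimitiveVec r) (hAr : A.mulVec r = 0)
    (hsupp : ∀ i, g i = 0 → r i = 0) {j : Fin n} (hj : 0 < g j * r j) : r = g := by
  have hprop : g j • r = r j • g := by
    by_contra hne
    have h0 : g j • r - r j • g ≠ 0 := sub_ne_zero.2 hne
    have := hg.2.2 _ h0 (by
      rw [Matrix.mulVec_sub, Matrix.mulVec_smul, Matrix.mulVec_smul, hAr, hg.2.1]; simp)
      (fun i hi => by simp [hi, hsupp i hi]) j (by simp [mul_comm])
    simp [this] at hj
  rcases pos_and_pos_or_neg_and_neg_of_mul_pos hj with ⟨h1, h2⟩ | ⟨h1, h2⟩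
  · exact hr.eq_of_smul_eq hg.1 h1 h2 hprop
  · exact hr.eq_of_smul_eq hg.1 (neg_pos.2 h1) (neg_pos.2 h2) (by simpa using hprop)

/-- An elementary vector is determined by its sign pattern, of which there are finitely many. -/
lemma finite_setOf_isElementary (A : Matrix (Fin d) (Fin n) ℤ) : {g | IsElementary A g}.Finite := by
  refine Set.Finite.of_injOn (f := fun (g : Fin n → ℤ) (i : Fin n) => SignType.sign (g i))
    (t := Set.univ) (fun _ _ => Set.mem_univ _) ?_ Set.finite_univ
  intro g hg r hr h
  have h' : ∀ i, SignType.sign (g i) = SignType.sign (r i) := fun i => congrFun h i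
  obtain ⟨j, hj⟩ := Function.ne_iff.1 hg.1.ne_zero
  refine (IsElementary.eq_of_support_subset hg hr.1 hr.2.1 (fun i hi => ?_) (j := j) ?_).symm
  · have := h' i
    rw [hi, sign_zero] at this
    exact sign_eq_zero_iff.1 this.symm
  · rw [← sign_eq_one_iff, sign_mul, ← h' j, ← sign_mul, sign_eq_one_iff]
    exact mul_self_pos.2 hj

/-- Ratio test: `t` is the least `y i / w i` over the indices where `w` and `y` have the same strict
sign. Up to `t`, subtracting `w` does not leave the orthant of `y`, and at `t` a coordinate dies. -/
lemma exists_max_step {y w : Fin n → ℝ} {j : Fin n} (hj : 0 < w j * y j) :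
    ∃ t : ℝ, 0 < t ∧ (∀ i, 0 ≤ (y i - t * w i) * y i) ∧ ∃ i, y i ≠ 0 ∧ y i - t * w i = 0 := by
  classical
  obtain ⟨k, hk, hmin⟩ := (Finset.univ.filter fun i => 0 < w i * y i).exists_min_image
    (fun i => y i / w i) ⟨j, by simpa using hj⟩
  simp only [Finset.mem_filter, Finset.mem_univ, true_and] at hk hmin
  have hpos : ∀ i, 0 < w i * y i → 0 < y i / w i := fun i hi => by
    have hw : w i ≠ 0 := fun h => by simp [h] at hi
    have : y i / w i = w i * y i / (w i) ^ 2 := by field_simp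
    rw [this]; positivity
  refine ⟨y k / w k, hpos k hk, fun i => ?_, k, fun h => by simp [h] at hk, ?_⟩
  · rcases le_or_gt (w i * y i) 0 with hi | hi
    · nlinarith [hpos k hk, mul_self_nonneg (y i)]
    · have h1 := hmin i hi
      have hw : w i ≠ 0 := fun h => by simp [h] at hi
      have h2 : y i / w i * (w i * y i) = y i * y i := by field_simp
      nlinarith
  · have hw : w k ≠ 0 := fun h => by simp [h] at hk
    field_simp
    ring

lemma support_ssubset_of_exists {x y : Fin n → ℝ} (h : ∀ i, y i = 0 → x i = 0)
    (h' : ∃ i, y i ≠ 0 ∧ x i = 0) : Function.support x ⊂ Function.support y := by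
  obtain ⟨i, hi, hi'⟩ := h'
  exact ⟨fun j hj hy => hj (h j hy), fun hs => hs (show i ∈ Function.support y from hi) hi'⟩

theorem exists_isElementary_conformal {A : Matrix (Fin d) (Fin n) ℤ} (y : Fin n → ℝ)
    (hA : (A.map (fun a : ℤ => (a : ℝ))).mulVec y = 0) (hy : y ≠ 0) :
    ∃ g, IsElementary A g ∧ ∀ i, 0 ≤ (g i : ℝ) * y i ∧ (y i = 0 → g i = 0) := by
  induction hk : (Function.support y).ncard using Nat.strong_induction_on generalizing y with
  | _ k ih =>
    subst hk
    -- Descend to a smaller support within the orthant of `y`, if there is one. Otherwise `y` itself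
    -- turns out to be a multiple of an elementary vector.
    by_cases h : ∃ x : Fin n → ℝ, x ≠ 0 ∧ (A.map (fun a : ℤ => (a : ℝ))).mulVec x = 0 ∧
        (∀ i, 0 ≤ x i * y i) ∧ Function.support x ⊂ Function.support y
    · obtain ⟨x, hx0, hAx, hxy, hss⟩ := h
      obtain ⟨g, hg, hgx⟩ := ih _ (Set.ncard_lt_ncard hss) x hAx hx0 rfl
      refine ⟨g, hg, fun i => ⟨?_, fun hi => (hgx i).2 ?_⟩⟩
      · by_cases hx : x i = 0
        · simp [(hgx i).2 hx]
        · have : 0 < x i * x i := mul_self_pos.2 hx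
          have h2 := mul_nonneg (hgx i).1 (hxy i)
          by_contra hneg
          push Not at hneg
          nlinarith
      · by_contra hx
        exact hss.1 hx hi
    -- The remainder of a maximal step along `w` has smaller support and lies in the same orthant,
    -- so by `h` it is zero.
    · have key : ∀ w : Fin n → ℤ, A.mulVec w = 0 → (∀ i, y i = 0 → w i = 0) →
          (∃ j, 0 < (w j : ℝ) * y j) → ∃ t : ℝ, 0 < t ∧ ∀ i, y i = t * w i := by
        rintro w hw hws ⟨j, hj⟩
        obtain ⟨t, ht, h1, h2⟩ := exists_max_step (w := toReal w) hj
        refine ⟨t, ht, ?_⟩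
        by_contra hne
        refine h ⟨y - t • toReal w, fun h0 => hne fun i => ?_, ?_, h1, ?_⟩
        · simpa [sub_eq_zero, toReal] using congrFun h0 i
        · rw [Matrix.mulVec_sub, Matrix.mulVec_smul, hA, map_mulVec_toReal_eq_zero.2 hw]
          simp
        · exact support_ssubset_of_exists (fun i hi => by simp [hi, toReal, hws i hi]) h2
      have key' : ∀ w : Fin n → ℤ, w ≠ 0 → A.mulVec w = 0 → (∀ i, y i = 0 → w i = 0) →
          ∃ t : ℝ, t ≠ 0 ∧ ∀ i, y i = t * w i := by
        intro w hw0 hw hws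
        obtain ⟨j, hj⟩ := Function.ne_iff.1 hw0
        have hj' : (w j : ℝ) ≠ 0 := by exact_mod_cast hj
        rcases (mul_ne_zero hj' (fun h => hj (hws j h))).lt_or_gt with hlt | hgt
        · obtain ⟨t, ht, h2⟩ := key (-w) (by rw [Matrix.mulVec_neg, hw, neg_zero])
            (fun i hi => by simp [hws i hi]) ⟨j, by simpa using hlt⟩
          exact ⟨-t, by simpa using ht.ne', fun i => by simpa using h2 i⟩
        · obtain ⟨t, ht, h2⟩ := key w hw hws ⟨j, hgt⟩
          exact ⟨t, ht.ne', h2⟩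
      have fin : ∀ (w : Fin n → ℤ) (t : ℝ), 0 < t → w ≠ 0 → A.mulVec w = 0 →
          (∀ i, y i = t * w i) →
          ∃ g, IsElementary A g ∧ ∀ i, 0 ≤ (g i : ℝ) * y i ∧ (y i = 0 → g i = 0) := by
        intro w t ht hw0 hw hyw
        obtain ⟨m, g, hm, hg, rfl⟩ := exists_primitive hw0
        have hm' : (0 : ℝ) < m := by exact_mod_cast hm
        have hyg : ∀ i, y i = (t * m) * g i := fun i => by rw [hyw i]; simp; ring
        have htm : 0 < t * m := by positivity
        have hz : ∀ i, y i = 0 ↔ g i = 0 := fun i => by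
          rw [hyg i]; simp [htm.ne']
        refine ⟨g, ⟨hg, ?_, fun v hv0 hv hvs i hi => ?_⟩, fun i => ⟨?_, (hz i).1⟩⟩
        · rw [Matrix.mulVec_smul] at hw
          exact (smul_eq_zero.1 hw).resolve_left hm.ne'
        · obtain ⟨s, hs, h2⟩ := key' v hv0 hv fun i hi => hvs i ((hz i).1 hi)
          rw [← hz, h2 i, hi]
          simp
        · rw [hyg i]
          nlinarith [mul_self_nonneg (g i : ℝ)]
      obtain ⟨w, hw0, hw, hws⟩ := exists_int_kernel hA hy
      obtain ⟨t, ht, h2⟩ := key' w hw0 hw hws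
      rcases ht.lt_or_gt with hlt | hgt
      · exact fin (-w) (-t) (neg_pos.2 hlt) (neg_ne_zero.2 hw0)
          (by rw [Matrix.mulVec_neg, hw, neg_zero]) fun i => by simpa using h2 i
      · exact fin w t hgt hw0 hw h2

theorem exists_isElementary_reducing {A : Matrix (Fin d) (Fin n) ℤ} (y : Fin n → ℝ)
    (hA : (A.map (fun a : ℤ => (a : ℝ))).mulVec y = 0) (hy : y ≠ 0) :
    ∃ g, IsElementary A g ∧ (∀ i, 0 ≤ (g i : ℝ) * y i) ∧ ∃ t : ℝ, 0 < t ∧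
      (∀ i, t * g i ∈ Set.uIcc 0 (y i)) ∧
      Function.support (y - t • toReal g) ⊂ Function.support y := by
  obtain ⟨g, hg, hgy⟩ := exists_isElementary_conformal y hA hy
  obtain ⟨j, hj⟩ := Function.ne_iff.1 hg.1.ne_zero
  have hj' : (g j : ℝ) ≠ 0 := by exact_mod_cast hj
  obtain ⟨t, ht, h1, h2⟩ := exists_max_step (w := toReal g) (y := y) (j := j)
    (lt_of_le_of_ne (hgy j).1 (mul_ne_zero hj' fun h => hj ((hgy j).2 h)).symm)
  refine ⟨g, hg, fun i => (hgy i).1, t, ht, fun i => ?_,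
    support_ssubset_of_exists (fun i hi => by simp [hi, toReal, (hgy i).2 hi]) h2⟩
  have h3 := h1 i
  have h4 := (hgy i).1
  simp only [toReal] at h3
  rw [Set.mem_uIcc]
  rcases lt_trichotomy (y i) 0 with hi | hi | hi
  · right
    constructor <;> nlinarith [nonpos_of_mul_nonneg_left h3 hi, nonpos_of_mul_nonneg_left h4 hi]
  · simp [hi, (hgy i).2 hi]
  · left
    constructor <;> nlinarith [nonneg_of_mul_nonneg_left h3 hi, nonneg_of_mul_nonneg_left h4 hi]

/-! ### Averaging the objective over a conformal decomposition. -/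

lemma objective_add (c : Fin n → ℚ) (y z : Fin n → ℝ) :
    objective c (y + z) = objective c y + objective c z := by
  simp [objective, mul_add, Finset.sum_add_distrib]

lemma objective_smul (c : Fin n → ℚ) (t : ℝ) (z : Fin n → ℝ) :
    objective c (t • z) = t * objective c z := by
  simp only [objective, Finset.mul_sum, Pi.smul_apply, smul_eq_mul]
  exact Finset.sum_congr rfl fun i _ => by ring

lemma objective_sub (c : Fin n → ℚ) (y z : Fin n → ℝ) :
    objective c (y - z) = objective c y - objective c z := by
  simp [objective, mul_sub, Finset.sum_sub_distrib]

lemma sub_mem_uIcc {v y : ℝ} (h : v ∈ Set.uIcc 0 y) : y - v ∈ Set.uIcc 0 y := by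
  rw [Set.mem_uIcc] at *
  rcases h with h | h
  · left; constructor <;> linarith
  · right; constructor <;> linarith

lemma uIcc_zero_trans {v x y : ℝ} (h : v ∈ Set.uIcc 0 x) (h' : x ∈ Set.uIcc 0 y) :
    v ∈ Set.uIcc 0 y :=
  Set.uIcc_subset_uIcc Set.left_mem_uIcc h' h

/-- Some elementary vector in a conformal decomposition of `y` does at least as well as the
average. -/
theorem exists_isElementary_average {A : Matrix (Fin d) (Fin n) ℤ} (c : Fin n → ℚ)
    (y : Fin n → ℝ) (hA : (A.map (fun a : ℤ => (a : ℝ))).mulVec y = 0)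
    (hc : objective c y < 0) :
    ∃ g, IsElementary A g ∧ ∃ t : ℝ, 0 ≤ t ∧ (∀ i, t * g i ∈ Set.uIcc 0 (y i)) ∧
      ((Function.support y).ncard : ℝ) * objective c (t • toReal g) ≤ objective c y := by
  induction hk : (Function.support y).ncard using Nat.strong_induction_on generalizing y with
  | _ k ih =>
    subst hk
    have hy : y ≠ 0 := by rintro rfl; simp [objective] at hc
    obtain ⟨g, hg, -, t, ht, hti, hss⟩ := exists_isElementary_reducing y hA hy
    set k := (Function.support y).ncard
    by_cases hav : (k : ℝ) * objective c (t • toReal g) ≤ objective c y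
    · exact ⟨g, hg, t, ht.le, hti, hav⟩
    push Not at hav
    have hlt := Set.ncard_lt_ncard hss
    set k' := (Function.support (y - t • toReal g)).ncard
    have hkk : (k' : ℝ) + 1 ≤ k := by exact_mod_cast hlt
    have hsub := objective_sub c y (t • toReal g)
    have hk0 : (0 : ℝ) ≤ k' := Nat.cast_nonneg _
    -- If the first summand misses the average, what remains has less than `(k - 1) / k` of the
    -- (negative) value of `y`, on a support of size at most `k - 1`. So its average is no worse
    -- than that of `y`.
    have hrest : k * objective c (y - t • toReal g) < (k - 1) * objective c y := by
      rw [hsub]; linarith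
    have hneg : objective c (y - t • toReal g) < 0 := by
      have : (k - 1) * objective c y ≤ 0 := mul_nonpos_of_nonneg_of_nonpos (by linarith) hc.le
      by_contra h
      push Not at h
      have := mul_nonneg (show (0 : ℝ) ≤ k by linarith) h
      linarith
    obtain ⟨g', hg', t', ht', hti', hav'⟩ := ih _ hlt (y - t • toReal g) (by
      rw [Matrix.mulVec_sub, Matrix.mulVec_smul, hA, map_mulVec_toReal_eq_zero.2 hg.2.1]; simp)
      hneg rfl
    refine ⟨g', hg', t', ht', fun i => uIcc_zero_trans (hti' i) ?_, ?_⟩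
    · simpa [toReal] using sub_mem_uIcc (hti i)

    set v := objective c (t' • toReal g')
    have hv : v < 0 := by
      by_contra h
      push Not at h
      have := mul_nonneg hk0 h
      linarith
    have h1 : (k - 1 : ℝ) * v ≤ k' * v :=
      mul_le_mul_of_nonpos_right (by linarith) hv.le
    -- For `k = 1` nothing would remain, although the remainder has negative objective.
    have hk1 : 0 < (k : ℝ) - 1 := by
      by_contra h
      have : (k' : ℝ) = 0 := by linarith
      rw [this] at hav'
      linarith
    have h2 : (k - 1 : ℝ) * (k * v) ≤ (k - 1) * objective c y := by nlinarith
    exact le_of_mul_le_mul_left h2 hk1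

/-! ### Circuits are the elementary vectors -/

lemma exists_signs (y : Fin n → ℝ) :
    ∃ s : Fin n → ℤˣ, ∀ i, 0 ≤ (((s i : ℤˣ) : ℤ) : ℝ) * y i := by
  refine ⟨fun i => if 0 ≤ y i then 1 else -1, fun i => ?_⟩
  by_cases h : 0 ≤ y i
  · simp [h]
  · simp [h, le_of_not_ge h]

lemma sign_mul_sign (e : ℤˣ) : (((e : ℤˣ) : ℤ) : ℝ) * (((e : ℤˣ) : ℤ) : ℝ) = 1 := by
  rcases Int.units_eq_one_or e with h | h <;> simp [h]

/-- The cone `ker A ∩ O_s` as a submodule over the nonnegative reals. -/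
def orthantSubmodule (A : Matrix (Fin d) (Fin n) ℤ) (s : Fin n → ℤˣ) :
    Submodule ℝ≥0 (Fin n → ℝ) where
  carrier := orthantCone A s
  zero_mem' := by simp [orthantCone]
  add_mem' := fun {x y} hx hy => by
    refine ⟨by rw [Matrix.mulVec_add, hx.1, hy.1, add_zero], fun i => ?_⟩
    rw [Pi.add_apply, mul_add]
    exact add_nonneg (hx.2 i) (hy.2 i)
  smul_mem' := fun t x hx => by
    refine ⟨?_, fun i => ?_⟩
    · rw [NNReal.smul_def, Matrix.mulVec_smul, hx.1, smul_zero]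
    · rw [NNReal.smul_def, Pi.smul_apply, smul_eq_mul, mul_left_comm]
      exact mul_nonneg t.2 (hx.2 i)

/-- Peeling off a conformal elementary vector keeps the remainder in the orthant and shrinks its
support. -/
lemma span_isElementary (A : Matrix (Fin d) (Fin n) ℤ) (s : Fin n → ℤˣ) :
    GeneratesCone A s {g | IsElementary A g ∧ toReal g ∈ orthantCone A s} := by
  refine ⟨fun v hv => hv.1.1, Set.Subset.antisymm ?_ ?_⟩
  · change _ ≤ orthantSubmodule A s
    rw [Submodule.span_le]
    rintro _ ⟨g, hg, rfl⟩
    exact hg.2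
  · intro y hy
    induction hk : (Function.support y).ncard using Nat.strong_induction_on generalizing y with
    | _ k ih =>
      subst hk
      by_cases hy0 : y = 0
      · subst hy0; exact Submodule.zero_mem _
      obtain ⟨g, hg, hgy, t, ht, hti, hss⟩ := exists_isElementary_reducing y hy.1 hy0
      have hsi : ∀ i, 0 ≤ (((s i : ℤˣ) : ℤ) : ℝ) * (t * g i) ∧
          0 ≤ (((s i : ℤˣ) : ℤ) : ℝ) * (y i - t * g i) := fun i => by
        have h1 := hy.2 i
        have h2 := Set.mem_uIcc.1 (hti i)
        rcases Int.units_eq_one_or (s i) with h | h <;> simp only [h, Units.val_one, Int.cast_one,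
          Units.val_neg, Int.cast_neg, one_mul, neg_one_mul] at h1 ⊢ <;>
          rcases h2 with h2 | h2 <;> constructor <;> linarith
      have hker : (A.map (fun a : ℤ => (a : ℝ))).mulVec (toReal g) = 0 :=
        map_mulVec_toReal_eq_zero.2 hg.2.1
      have hrec := ih _ (Set.ncard_lt_ncard hss) (y := y - t • toReal g)
        ⟨by rw [Matrix.mulVec_sub, Matrix.mulVec_smul, hy.1, hker]; simp,
          fun i => by simpa [toReal] using (hsi i).2⟩ rfl
      have hgmem : toReal g ∈ Submodule.span ℝ≥0
          (toReal '' {g | IsElementary A g ∧ toReal g ∈ orthantCone A s}) := by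
        refine Submodule.subset_span ⟨g, ⟨hg, hker, fun i => ?_⟩, rfl⟩
        have := (hsi i).1
        rw [mul_left_comm] at this
        exact nonneg_of_mul_nonneg_right this ht
      have : y = (y - t • toReal g) + t.toNNReal • toReal g := by
        ext i
        simp [NNReal.smul_def, ht.le]
      rw [this]
      exact Submodule.add_mem _ hrec (Submodule.smul_mem _ _ hgmem)

/-- Within one orthant sums do not cancel, so the support of a sum contains that of each summand.
This carries the claim through the span. -/
lemma exists_mem_support_subset {A : Matrix (Fin d) (Fin n) ℤ} {s : Fin n → ℤˣ}
    {R : Set (Fin n → ℤ)} (hR : GeneratesCone A s R) {y : Fin n → ℝ} (hy : y ∈ orthantCone A s)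
    (hy0 : y ≠ 0) : ∃ r ∈ R, ∀ i, y i = 0 → r i = 0 := by
  have hmem : y ∈ Submodule.span ℝ≥0 (toReal '' R) := by
    rw [← SetLike.mem_coe, hR.2]
    exact hy
  clear hy
  induction hmem using Submodule.span_induction with
  | mem x hx =>
    obtain ⟨r, hr, rfl⟩ := hx
    exact ⟨r, hr, fun i hi => by simpa [toReal] using hi⟩
  | zero => exact absurd rfl hy0
  | add x z hx hz ihx ihz =>
    have hx' : x ∈ orthantCone A s := hR.2 ▸ hx
    have hz' : z ∈ orthantCone A s := hR.2 ▸ hz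
    have hzero : ∀ i, (x + z) i = 0 → x i = 0 ∧ z i = 0 := fun i hi => by
      have h1 := hx'.2 i
      have h2 := hz'.2 i
      rw [Pi.add_apply] at hi
      rcases Int.units_eq_one_or (s i) with h | h <;> simp only [h, Units.val_one, Int.cast_one,
          Units.val_neg, Int.cast_neg, one_mul, neg_one_mul] at h1 h2 <;> constructor <;> linarith
    by_cases hx0 : x = 0
    · obtain ⟨r, hr, h⟩ := ihz (by rintro rfl; simp [hx0] at hy0)
      exact ⟨r, hr, fun i hi => h i (hzero i hi).2⟩
    · obtain ⟨r, hr, h⟩ := ihx hx0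
      exact ⟨r, hr, fun i hi => h i (hzero i hi).1⟩
  | smul t x hx ih =>
    obtain ⟨r, hr, h⟩ := ih (by rintro rfl; simp at hy0)
    refine ⟨r, hr, fun i hi => h i ?_⟩
    have ht : t ≠ 0 := by rintro rfl; simp at hy0
    simpa [NNReal.smul_def, ht] using hi

/-- Makes the elementary vectors of an orthant the least generating set, hence the only minimal one.
-/
lemma isElementary_mem_of_generatesCone {A : Matrix (Fin d) (Fin n) ℤ} {s : Fin n → ℤˣ}
    {R : Set (Fin n → ℤ)} (hR : GeneratesCone A s R) {g : Fin n → ℤ} (hg : IsElementary A g)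
    (hgs : toReal g ∈ orthantCone A s) : g ∈ R := by
  obtain ⟨r, hr, hsupp⟩ := exists_mem_support_subset hR hgs
    (fun h => hg.1.ne_zero (toReal_eq_zero.1 h))
  have hrs : toReal r ∈ orthantCone A s := by
    rw [← hR.2]
    exact Submodule.subset_span ⟨r, hr, rfl⟩
  have hprim := hR.1 r hr
  obtain ⟨j, hj⟩ := Function.ne_iff.1 hprim.ne_zero
  have hgj : g j ≠ 0 := fun h => hj (hsupp j (by simpa [toReal] using h))
  have hpos : (0 : ℝ) < g j * r j := by
    refine lt_of_le_of_ne ?_ (by exact_mod_cast (mul_ne_zero hgj hj).symm)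
    have := mul_nonneg (hgs.2 j) (hrs.2 j)
    rwa [mul_mul_mul_comm, sign_mul_sign, one_mul] at this
  rw [← hg.eq_of_support_subset hprim (map_mulVec_toReal_eq_zero.1 hrs.1)
    (fun i hi => hsupp i (by simp [toReal, hi])) (by exact_mod_cast hpos)]
  exact hr

theorem mem_circuits_iff {A : Matrix (Fin d) (Fin n) ℤ} {g : Fin n → ℤ} :
    g ∈ circuits A ↔ IsElementary A g := by
  constructor
  · rintro ⟨-, s, R, hR, hg⟩
    exact (hR.2 (span_isElementary A s)
      (fun g hg => isElementary_mem_of_generatesCone hR.1 hg.1 hg.2) hg).1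
  · intro hg
    obtain ⟨s, hs⟩ := exists_signs (toReal g)
    exact ⟨hg.1.ne_zero, s, _, ⟨span_isElementary A s, fun R hR _ r hr =>
      isElementary_mem_of_generatesCone hR hr.1 hr.2⟩,
      hg, map_mulVec_toReal_eq_zero.2 hg.2.1, hs⟩

/-! ### The Graver basis -/

/-- The lattice points of an orthant of the kernel as a submonoid. -/
def orthantMonoid (A : Matrix (Fin d) (Fin n) ℤ) (s : Fin n → ℤˣ) :
    AddSubmonoid (Fin n → ℤ) where
  carrier := orthantLattice A s
  zero_mem' := by simp [orthantLattice]
  add_mem' := fun {x y} hx hy => by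
    refine ⟨by rw [Matrix.mulVec_add, hx.1, hy.1, add_zero], fun i => ?_⟩
    rw [Pi.add_apply, mul_add]
    exact add_nonneg (hx.2 i) (hy.2 i)

/-- The indecomposable elements of `ker A ∩ O_s ∩ ℤⁿ`. -/
def indecomposables (A : Matrix (Fin d) (Fin n) ℤ) (s : Fin n → ℤˣ) : Set (Fin n → ℤ) :=
  {x | x ∈ orthantMonoid A s ∧ x ≠ 0 ∧
    ∀ y ∈ orthantMonoid A s, ∀ z ∈ orthantMonoid A s, x = y + z → y = 0 ∨ z = 0}

/-- A multiple `(m + 1) • v` splits as `v + m • v`, which indecomposability allows only for `m = 0`.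
-/
lemma isPrimitiveVec_of_mem_indecomposables {A : Matrix (Fin d) (Fin n) ℤ} {s : Fin n → ℤˣ}
    {x : Fin n → ℤ} (hx : x ∈ indecomposables A s) : IsPrimitiveVec x := by
  obtain ⟨k, v, hk, hv, rfl⟩ := exists_primitive hx.2.1
  obtain ⟨m, rfl⟩ : ∃ m : ℕ, k = m + 1 := ⟨(k - 1).toNat, by omega⟩
  have hvm : v ∈ orthantMonoid A s := by
    obtain ⟨h1, h2⟩ := hx.1
    rw [Matrix.mulVec_smul] at h1
    refine ⟨(smul_eq_zero.1 h1).resolve_left hk.ne', fun i => ?_⟩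
    have := h2 i
    rw [Pi.smul_apply, smul_eq_mul, mul_left_comm] at this
    exact nonneg_of_mul_nonneg_right this hk
  rcases hx.2.2 v hvm (m • v) (AddSubmonoid.nsmul_mem _ hvm m)
    (by rw [add_smul, one_smul, add_comm, natCast_zsmul]) with h | h
  · exact absurd h hv.ne_zero
  · have hm : m = 0 := (smul_eq_zero.1 h).resolve_right hv.ne_zero
    simpa [hm] using hv

lemma sum_natAbs_add {A : Matrix (Fin d) (Fin n) ℤ} {s : Fin n → ℤˣ} {y z : Fin n → ℤ}
    (hy : y ∈ orthantMonoid A s) (hz : z ∈ orthantMonoid A s) (i : Fin n) :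
    ((y + z) i).natAbs = (y i).natAbs + (z i).natAbs := by
  have h1 := hy.2 i
  have h2 := hz.2 i
  rcases Int.units_eq_one_or (s i) with h | h <;> simp only [h, Units.val_one,
    Units.val_neg, one_mul, neg_one_mul, Pi.add_apply] at h1 h2 ⊢ <;> omega

/-- The `ℓ¹` norm is additive on an orthant, so both parts of a proper splitting are smaller and
induction applies. -/
lemma closure_indecomposables (A : Matrix (Fin d) (Fin n) ℤ) (s : Fin n → ℤˣ) :
    AddSubmonoid.closure (indecomposables A s) = orthantMonoid A s := by
  refine le_antisymm (AddSubmonoid.closure_le.2 fun x hx => hx.1) ?_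
  intro x hx
  induction hk : ∑ i, (x i).natAbs using Nat.strong_induction_on generalizing x with
  | _ k ih =>
    subst hk
    by_cases h0 : x = 0
    · subst h0; exact AddSubmonoid.zero_mem _
    by_cases hxi : x ∈ indecomposables A s
    · exact AddSubmonoid.subset_closure hxi
    have : ∃ y ∈ orthantMonoid A s, ∃ z ∈ orthantMonoid A s, x = y + z ∧ y ≠ 0 ∧ z ≠ 0 := by
      by_contra h
      refine hxi ⟨hx, h0, fun y hy z hz hxyz => ?_⟩
      by_contra h'
      push Not at h'
      exact h ⟨y, hy, z, hz, hxyz, h'⟩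
    obtain ⟨y, hy, z, hz, rfl, hy0, hz0⟩ := this
    have hsum : ∑ i, ((y + z) i).natAbs = ∑ i, (y i).natAbs + ∑ i, (z i).natAbs := by
      rw [← Finset.sum_add_distrib]
      exact Finset.sum_congr rfl fun i _ => sum_natAbs_add hy hz i
    have hpos : ∀ v : Fin n → ℤ, v ≠ 0 → 0 < ∑ i, (v i).natAbs := fun v hv => by
      obtain ⟨i, hi⟩ := Function.ne_iff.1 hv
      exact Finset.sum_pos' (fun _ _ => Nat.zero_le _)
        ⟨i, Finset.mem_univ i, Int.natAbs_pos.2 hi⟩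
    have h1 := hpos y hy0
    have h2 := hpos z hz0
    exact AddSubmonoid.add_mem _ (ih (∑ i, (y i).natAbs) (by omega) hy rfl)
      (ih (∑ i, (z i).natAbs) (by omega) hz rfl)

lemma minimal_indecomposables (A : Matrix (Fin d) (Fin n) ℤ) (s : Fin n → ℤˣ) :
    Minimal (GeneratesLattice A s) (indecomposables A s) := by
  refine ⟨⟨fun v hv => isPrimitiveVec_of_mem_indecomposables hv, ?_⟩, fun H hH _ x hx => ?_⟩
  · rw [closure_indecomposables]; rfl
  · have hcl : AddSubmonoid.closure H = orthantMonoid A s := SetLike.coe_injective hH.2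
    have hmem : x ∈ AddSubmonoid.closure H := hcl ▸ hx.1
    induction hmem using AddSubmonoid.closure_induction with
    | mem y hy => exact hy
    | zero => exact absurd rfl hx.2.1
    | add y z hy hz ihy ihz =>
      rcases hx.2.2 y (hcl ▸ hy) z (hcl ▸ hz) rfl with rfl | rfl
      · rw [zero_add] at hx ⊢
        exact ihz hx
      · rw [add_zero] at hx ⊢
        exact ihy hx

/-- This inclusion suffices: good steps only require enough directions, and greedy integer steps
exist for any direction set because the feasible set is finite. -/
lemma mem_graverBasis_of_mem_indecomposables {A : Matrix (Fin d) (Fin n) ℤ} {s : Fin n → ℤˣ}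
    {x : Fin n → ℤ} (hx : x ∈ indecomposables A s) : x ∈ graverBasis A :=
  ⟨hx.2.1, s, _, minimal_indecomposables A s, hx⟩

/-- If an `ℕ`-combination has the smallest possible support, the subsets of the support have
pairwise distinct sums. -/
lemma injOn_sum_of_minimal_support {M : Type*} [AddCommGroup M] [DecidableEq M] (a : M →₀ ℕ)
    (hmin : ∀ a' : M →₀ ℕ, a'.support ⊆ a.support → (a'.sum fun h k => k • h) =
      (a.sum fun h k => k • h) → a.support ⊆ a'.support) :
    Set.InjOn (fun T : Finset M => ∑ h ∈ T, h) (a.support.powerset : Set (Finset M)) := by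
  have key : ∀ T₁ ⊆ a.support, ∀ T₂ ⊆ a.support, ∑ h ∈ T₁, h = ∑ h ∈ T₂, h → T₁ ⊆ T₂ := by
    intro T₁ h₁ T₂ h₂ hsum
    by_contra hnot
    obtain ⟨h0, hh0⟩ : (T₁ \ T₂).Nonempty := Finset.sdiff_nonempty.2 hnot
    -- Exchange argument: move `a k` units of weight from `T₁ \ T₂` to `T₂ \ T₁`. The total is
    -- unchanged, and the smallest coefficient `a k` drops to zero, against minimality. The
    -- truncated subtraction in `f` is exact on `T₁ \ T₂` by the choice of `k`.
    obtain ⟨k, hk, hkmin⟩ := (T₁ \ T₂).exists_min_image (fun h => a h) ⟨h0, hh0⟩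
    have hsum' : ∑ h ∈ T₁ \ T₂, h = ∑ h ∈ T₂ \ T₁, h := by
      have e1 := Finset.sum_inter_add_sum_sdiff T₁ T₂ (fun h : M => h)
      have e2 := Finset.sum_inter_add_sum_sdiff T₂ T₁ (fun h : M => h)
      rw [Finset.inter_comm] at e2
      exact add_left_cancel (e1.trans (hsum.trans e2.symm))
    let f : M → ℕ := fun h => (a h - if h ∈ T₁ \ T₂ then a k else 0) +
      if h ∈ T₂ \ T₁ then a k else 0
    have hf : ∀ h, f h ≠ 0 → h ∈ a.support := by
      intro h hh
      by_contra hna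
      have hz := Finsupp.notMem_support_iff.1 hna
      have : h ∉ T₂ \ T₁ := fun hm => hna (h₂ (Finset.mem_sdiff.1 hm).1)
      simp only [f, hz, if_neg this, Nat.zero_sub, add_zero] at hh
      exact hh rfl
    let a' : M →₀ ℕ := Finsupp.onFinset a.support f hf
    have hsub : a'.support ⊆ a.support := Finsupp.support_onFinset_subset
    have hks := Finset.mem_sdiff.1 hk
    have hval : (a'.sum fun h k => k • h) = (a.sum fun h k => k • h) := by
      rw [Finsupp.sum_of_support_subset _ hsub _ (by simp), Finsupp.sum]
      have hterm : ∀ h ∈ a.support, a' h • h = (a h • h -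
          if h ∈ T₁ \ T₂ then a k • h else 0) + if h ∈ T₂ \ T₁ then a k • h else 0 := by
        intro h _
        change f h • h = _
        simp only [f]
        by_cases m1 : h ∈ T₁ \ T₂
        · have m2 : h ∉ T₂ \ T₁ := fun m => (Finset.mem_sdiff.1 m).2 (Finset.mem_sdiff.1 m1).1
          rw [if_pos m1, if_pos m1, if_neg m2, if_neg m2, add_zero, add_zero,
            eq_sub_iff_add_eq, ← add_smul, Nat.sub_add_cancel (hkmin h m1)]
        · rw [if_neg m1, if_neg m1, Nat.sub_zero, sub_zero, add_smul]
          split_ifs <;> simp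
      rw [Finset.sum_congr rfl hterm, Finset.sum_add_distrib, Finset.sum_sub_distrib,
        ← Finset.sum_filter, ← Finset.sum_filter, ← Finset.smul_sum, ← Finset.smul_sum,
        Finset.filter_mem_eq_inter, Finset.filter_mem_eq_inter,
        Finset.inter_eq_right.2 (Finset.sdiff_subset.trans h₁),
        Finset.inter_eq_right.2 (Finset.sdiff_subset.trans h₂), hsum', sub_add_cancel]
    have hk' := Finsupp.mem_support_iff.1 (hmin a' hsub hval (h₁ hks.1))
    refine hk' ?_
    change f k = 0
    simp [f, hks.1, hks.2]
  intro T₁ h₁ T₂ h₂ h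
  simp only [Finset.coe_powerset, Set.mem_preimage, Set.mem_powerset_iff, Finset.coe_subset]
    at h₁ h₂
  exact Finset.Subset.antisymm (key _ h₁ _ h₂ h) (key _ h₂ _ h₁ h.symm)

/-- Every lattice point of an orthant of the kernel is a nonnegative integer combination of at most
`log₂ ∏ (|xᵢ| + 1)` elements of the Graver basis of the same orthant. -/
theorem exists_short_decomposition {A : Matrix (Fin d) (Fin n) ℤ} {s : Fin n → ℤˣ}
    {x : Fin n → ℤ} (hx : x ∈ orthantMonoid A s) :
    ∃ a : (Fin n → ℤ) →₀ ℕ, (∀ h ∈ a.support, h ∈ indecomposables A s) ∧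
      (a.sum fun h k => k • h) = x ∧ 2 ^ a.support.card ≤ ∏ i, ((x i).natAbs + 1) := by
  classical
  have hex : ∃ m, ∃ a : (Fin n → ℤ) →₀ ℕ, (∀ h ∈ a.support, h ∈ indecomposables A s) ∧
      (a.sum fun h k => k • h) = x ∧ a.support.card = m := by
    rw [← closure_indecomposables, ← Submodule.span_nat_eq_addSubmonoidClosure] at hx
    obtain ⟨a, h1, h2⟩ := Submodule.mem_span_set.1 hx
    exact ⟨_, a, fun h hh => h1 hh, h2, rfl⟩
  obtain ⟨a, h1, h2, h3⟩ := Nat.find_spec hex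
  refine ⟨a, h1, h2, ?_⟩
  have hinj := injOn_sum_of_minimal_support a fun a' hs hv => by
    have := Nat.find_min' hex ⟨a', fun h hh => h1 h (hs hh), hv.trans h2, rfl⟩
    exact (Finset.eq_of_subset_of_card_le hs (h3.le.trans this)).symm.subset
  have hmem : ∀ T ⊆ a.support, ∑ h ∈ T, h ∈ orthantMonoid A s := fun T hT =>
    AddSubmonoid.sum_mem _ fun h hh => (h1 h (hT hh)).1
  rw [← Finset.card_powerset]
  -- The subset sums are pairwise distinct and lie in the box between `0` and `x`. As `s` fixes the
  -- signs, they can be told apart by absolute values.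
  calc a.support.powerset.card
      ≤ (Fintype.piFinset fun i => Finset.range ((x i).natAbs + 1)).card := by
        refine Finset.card_le_card_of_injOn (fun T i => ((∑ h ∈ T, h) i).natAbs) ?_ ?_
        · intro T hT
          have hT' : T ⊆ a.support := by simpa using hT
          simp only [Finset.mem_coe, Fintype.mem_piFinset, Finset.mem_range, Nat.lt_succ_iff]
          intro i
          -- Every coefficient on the support is at least `1`, so taking away a subset sum leaves a
          -- nonnegative combination.
          have hrest : ∑ h ∈ a.support, a h • h - ∑ h ∈ T, h ∈ orthantMonoid A s := by
            have : ∑ h ∈ a.support, a h • h - ∑ h ∈ T, h =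
                ∑ h ∈ a.support, (a h - if h ∈ T then 1 else 0) • h := by
              rw [sub_eq_iff_eq_add]
              have e : ∑ h ∈ T, h = ∑ h ∈ a.support, (if h ∈ T then 1 else 0) • h := by
                simp only [ite_smul, one_smul, zero_smul]
                rw [← Finset.sum_filter, Finset.filter_mem_eq_inter, Finset.inter_eq_right.2 hT']
              rw [e, ← Finset.sum_add_distrib]
              refine Finset.sum_congr rfl fun h hh => ?_
              have := Finsupp.mem_support_iff.1 hh
              rw [← add_smul, Nat.sub_add_cancel]
              split_ifs <;> omega
            rw [this]
            exact AddSubmonoid.sum_mem _ fun h hh => AddSubmonoid.nsmul_mem _ (h1 h hh).1 _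
          have e := sum_natAbs_add (hmem T hT') hrest i
          rw [add_sub_cancel] at e
          rw [show ∑ h ∈ a.support, a h • h = x from h2] at e
          omega
        · intro T₁ hT₁ T₂ hT₂ h
          refine hinj hT₁ hT₂ (funext fun i => ?_)
          have e1 := (hmem T₁ (by simpa using hT₁)).2 i
          have e2 := (hmem T₂ (by simpa using hT₂)).2 i
          have e3 := congrFun h i
          simp only at e3 ⊢
          rcases Int.units_eq_one_or (s i) with h | h <;> simp only [h, Units.val_one,
            Units.val_neg, one_mul, neg_one_mul] at e1 e2 <;> omega
    _ = ∏ i, ((x i).natAbs + 1) := by simp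

/-! ### Encoding lengths bound the data -/

lemma natAbs_lt_two_pow_intLength (a : ℤ) : a.natAbs + 1 ≤ 2 ^ intLength a :=
  (Nat.le_pow_clog (by norm_num) _).trans (Nat.pow_le_pow_right (by norm_num) (by simp [intLength]))

lemma one_le_ratLength (q : ℚ) : 1 ≤ ratLength q := by
  unfold ratLength intLength
  omega

lemma abs_add_one_le_two_pow_ratLength (q : ℚ) : |(q : ℝ)| + 1 ≤ 2 ^ ratLength q := by
  have h1 : |(q : ℝ)| ≤ (q.num.natAbs : ℝ) := by
    rw [Rat.cast_def, abs_div, Nat.abs_cast, Nat.cast_natAbs, Int.cast_abs]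
    exact div_le_self (abs_nonneg _) (by exact_mod_cast q.pos)
  have h2 : (q.num.natAbs : ℝ) + 1 ≤ 2 ^ intLength q.num := by
    exact_mod_cast natAbs_lt_two_pow_intLength q.num
  have h3 : (2 : ℝ) ^ intLength q.num ≤ 2 ^ ratLength q :=
    pow_le_pow_right₀ (by norm_num) (by simp [ratLength])
  linarith

lemma den_le_two_pow_ratLength (q : ℚ) : q.den ≤ 2 ^ ratLength q := by
  have := natAbs_lt_two_pow_intLength (q.den : ℤ)
  have h3 : 2 ^ intLength (q.den : ℤ) ≤ 2 ^ ratLength q :=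
    Nat.pow_le_pow_right (by norm_num) (by simp [ratLength])
  simp only [Int.natAbs_natCast] at this
  omega

lemma prod_den_le {q : Fin n → ℚ} {L : ℕ} (h : ∑ i, ratLength (q i) ≤ L) :
    ∏ i, (q i).den ≤ 2 ^ L := by
  refine le_trans ?_ (Nat.pow_le_pow_right (by norm_num) h)
  rw [← Finset.prod_pow_eq_pow_sum]
  exact Finset.prod_le_prod' fun i _ => den_le_two_pow_ratLength (q i)

lemma abs_le_two_pow {q : Fin n → ℚ} {L : ℕ} (h : ∑ i, ratLength (q i) ≤ L) (i : Fin n) :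
    |(q i : ℝ)| ≤ 2 ^ L := by
  have h1 := abs_add_one_le_two_pow_ratLength (q i)
  have h2 : ratLength (q i) ≤ L :=
    (Finset.single_le_sum (f := fun i => ratLength (q i)) (fun _ _ => Nat.zero_le _)
      (Finset.mem_univ i)).trans h
  have h3 : (2 : ℝ) ^ ratLength (q i) ≤ 2 ^ L := pow_le_pow_right₀ (by norm_num) h2
  linarith

lemma card_le_of_sum_ratLength_le {q : Fin n → ℚ} {L : ℕ} (h : ∑ i, ratLength (q i) ≤ L) :
    n ≤ L := by
  refine le_trans ?_ h
  have := Finset.card_nsmul_le_sum Finset.univ (fun i => ratLength (q i)) 1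
    fun i _ => one_le_ratLength _
  simpa using this

section inputLength

variable (A : Matrix (Fin d) (Fin n) ℤ) (u : Fin n → ℚ) (b : Fin d → ℤ) (c z₀ : Fin n → ℚ)

lemma sum_ratLength_u_le : ∑ i, ratLength (u i) ≤ inputLength A u b c z₀ := by
  unfold inputLength; omega

lemma sum_ratLength_c_le : ∑ i, ratLength (c i) ≤ inputLength A u b c z₀ := by
  unfold inputLength; omega

lemma columns_le_inputLength : n ≤ inputLength A u b c z₀ :=
  card_le_of_sum_ratLength_le (sum_ratLength_u_le A u b c z₀)

lemma rows_le_inputLength : d ≤ inputLength A u b c z₀ := by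
  have h : ∑ j, intLength (b j) ≤ inputLength A u b c z₀ := by unfold inputLength; omega
  refine le_trans ?_ h
  have := Finset.card_nsmul_le_sum Finset.univ (fun j => intLength (b j)) 1
    fun i _ => by simp [intLength]
  simpa using this

lemma abs_entry_le (j : Fin d) (i : Fin n) : |A j i| ≤ 2 ^ inputLength A u b c z₀ := by
  have h : intLength (A j i) ≤ inputLength A u b c z₀ := by
    have h1 : intLength (A j i) ≤ ∑ i, intLength (A j i) :=
      Finset.single_le_sum (f := fun i => intLength (A j i)) (fun _ _ => Nat.zero_le _)
        (Finset.mem_univ i)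
    have h2 : ∑ i, intLength (A j i) ≤ ∑ j, ∑ i, intLength (A j i) :=
      Finset.single_le_sum (f := fun j => ∑ i, intLength (A j i)) (fun _ _ => Nat.zero_le _)
        (Finset.mem_univ j)
    unfold inputLength; omega
  have h1 := natAbs_lt_two_pow_intLength (A j i)
  have h2 : 2 ^ intLength (A j i) ≤ 2 ^ inputLength A u b c z₀ :=
    Nat.pow_le_pow_right (by norm_num) h
  rw [Int.abs_eq_natAbs]
  exact_mod_cast (by omega : (A j i).natAbs ≤ 2 ^ inputLength A u b c z₀)

lemma abs_det_restrictedGram_le (S : Set (Fin n)) :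
    |(restrictedGram A S).det| ≤ 2 ^ (4 * inputLength A u b c z₀ ^ 2) := by
  classical
  set L := inputLength A u b c z₀
  have hd : d + 1 ≤ 2 ^ L :=
    (Nat.succ_le_succ (rows_le_inputLength A u b c z₀)).trans Nat.lt_two_pow_self
  have hn : n ≤ L := columns_le_inputLength A u b c z₀
  have hentry : ∀ i j, |restrictedGram A S i j| ≤ 2 ^ (3 * L) := by
    intro i j
    have h1 : |(A.transpose * A) i j| ≤ d * (2 ^ L * 2 ^ L) := by
      rw [Matrix.mul_apply]
      refine (Finset.abs_sum_le_sum_abs _ _).trans ?_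
      refine (Finset.sum_le_card_nsmul _ _ (2 ^ L * 2 ^ L) fun k _ => ?_).trans (by simp)
      rw [abs_mul]
      exact mul_le_mul (abs_entry_le A u b c z₀ k i) (abs_entry_le A u b c z₀ k j)
        (abs_nonneg _) (by positivity)
    have h2 : |(Matrix.diagonal (Sᶜ.indicator 1) : Matrix (Fin n) (Fin n) ℤ) i j| ≤ 1 := by
      by_cases hij : i = j
      · subst hij
        by_cases hi : i ∈ S <;> simp [hi]
      · simp [hij]
    have h3 := abs_add_le ((A.transpose * A) i j)
      ((Matrix.diagonal (Sᶜ.indicator 1) : Matrix (Fin n) (Fin n) ℤ) i j)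
    have h4 : (1 : ℤ) ≤ 2 ^ L := one_le_pow₀ (by norm_num)
    have hd' : (d : ℤ) + 1 ≤ 2 ^ L := by exact_mod_cast hd
    -- An entry is at most `d * 2 ^ (2 * L) + 1`, and `d + 1 ≤ 2 ^ L`.
    rw [restrictedGram, Matrix.add_apply, show 3 * L = L + L + L by ring, pow_add, pow_add]
    nlinarith [mul_le_mul h4 h4 (by norm_num) (by positivity)]
  have h := Matrix.det_le (A := restrictedGram A S) (abv := AbsoluteValue.abs)
    (x := (2 : ℤ) ^ (3 * L)) hentry
  rw [AbsoluteValue.abs_apply, Fintype.card_fin, nsmul_eq_mul] at h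
  refine h.trans ?_
  -- `Matrix.det_le` is the Leibniz bound: `n!` terms, each a product of `n` entries.
  have hfac : n.factorial ≤ 2 ^ (L ^ 2) :=
    calc n.factorial ≤ n ^ n := Nat.factorial_le_pow n
      _ ≤ (2 ^ L) ^ n := Nat.pow_le_pow_left (hn.trans Nat.lt_two_pow_self.le) n
      _ = 2 ^ (L * n) := (pow_mul _ _ _).symm
      _ ≤ 2 ^ (L ^ 2) := Nat.pow_le_pow_right (by norm_num) (by nlinarith)
  have hfac' : (n.factorial : ℤ) ≤ 2 ^ (L ^ 2) := by exact_mod_cast hfac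
  calc (n.factorial : ℤ) * (2 ^ (3 * L)) ^ n ≤ 2 ^ (L ^ 2) * 2 ^ (3 * L ^ 2) := by
        refine mul_le_mul hfac' ?_ (by positivity) (by positivity)
        rw [← pow_mul]
        exact pow_le_pow_right₀ (by norm_num) (by nlinarith)
    _ = 2 ^ (4 * L ^ 2) := by rw [← pow_add]; congr 1; ring

lemma objective_sub_le {y z : Fin n → ℝ} (hy : y ∈ lpFeasible A u b) (hz : z ∈ lpFeasible A u b) :
    objective c z - objective c y ≤ 2 ^ (3 * inputLength A u b c z₀) := by
  set L := inputLength A u b c z₀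
  have hn : (n : ℝ) ≤ 2 ^ L := by
    exact_mod_cast (columns_le_inputLength A u b c z₀).trans Nat.lt_two_pow_self.le
  have h1 : objective c z - objective c y ≤ n * (2 ^ L * 2 ^ L) := by
    rw [← objective_sub, objective]
    refine (Finset.sum_le_card_nsmul _ _ ((2 : ℝ) ^ L * 2 ^ L) fun i _ => ?_).trans (by simp)
    refine (le_abs_self _).trans ?_
    rw [abs_mul]
    refine mul_le_mul (abs_le_two_pow (sum_ratLength_c_le A u b c z₀) i) ?_ (abs_nonneg _)
      (by positivity)
    have h2 := abs_le_two_pow (sum_ratLength_u_le A u b c z₀) i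
    have h3 := hy.2 i
    have h4 := hz.2 i
    have h5 := le_abs_self (u i : ℝ)
    rw [Pi.sub_apply, abs_le]
    constructor <;> linarith
  refine h1.trans ?_
  rw [show 3 * L = L + (L + L) by ring, pow_add, pow_add]
  exact mul_le_mul_of_nonneg_right hn (by positivity)

end inputLength

/-! ### Integrality of scaled objective values -/

lemma intCast_mem (k : ℤ) : (k : ℝ) ∈ (Int.castRingHom ℝ).range := ⟨k, rfl⟩

lemma prod_den_mul_mem (q : Fin n → ℚ) (i : Fin n) :
    ((∏ j, (q j).den : ℕ) : ℝ) * (q i : ℝ) ∈ (Int.castRingHom ℝ).range := by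
  classical
  rw [← Finset.mul_prod_erase Finset.univ (fun j => (q j).den) (Finset.mem_univ i)]
  refine ⟨(∏ j ∈ Finset.univ.erase i, (q j).den : ℕ) * (q i).num, ?_⟩
  have h : ((q i).den : ℝ) * (q i : ℝ) = (q i).num := by
    rw [mul_comm]
    exact_mod_cast Rat.mul_den_eq_num (q i)
  rw [eq_intCast, Int.cast_mul, Int.cast_natCast, ← h]
  push_cast
  ring

lemma objective_mem {c : Fin n → ℚ} {z : Fin n → ℝ} {D : ℝ}
    (hz : ∀ i, D * z i ∈ (Int.castRingHom ℝ).range) :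
    ((∏ j, (c j).den : ℕ) : ℝ) * D * objective c z ∈ (Int.castRingHom ℝ).range := by
  rw [objective, Finset.mul_sum]
  refine sum_mem fun i _ => ?_
  have := mul_mem (prod_den_mul_mem c i) (hz i)
  convert this using 1
  ring

lemma one_le_abs_mul {K x : ℝ} (hK : K ≠ 0) (hx : 0 < x)
    (h : K * x ∈ (Int.castRingHom ℝ).range) : 1 ≤ |K| * x := by
  obtain ⟨k, hk⟩ := h
  rw [eq_intCast] at hk
  have hk0 : k ≠ 0 := by
    rintro rfl
    simp only [Int.cast_zero] at hk
    exact mul_ne_zero hK hx.ne' hk.symm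
  rw [← abs_of_pos hx, ← abs_mul, ← hk]
  exact_mod_cast Int.one_le_abs hk0

/-- The indices at which `z` lies strictly between its bounds. -/
def freeIndices (u : Fin n → ℚ) (z : Fin n → ℝ) : Set (Fin n) := {i | 0 < z i ∧ z i < u i}

/-- Cramer's rule: `M z` equals `Aᵀ b` plus the coordinates of `z` that sit at a bound, each `0` or
`u j`. The denominators of `u` thus clear `M z`, and the adjugate of `M` is integral. -/
lemma det_mul_prod_den_mul_mem {A : Matrix (Fin d) (Fin n) ℤ} {u : Fin n → ℚ} {b : Fin d → ℤ}
    {z : Fin n → ℝ} (hz : z ∈ lpFeasible A u b) (i : Fin n) :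
    ((restrictedGram A (freeIndices u z)).det : ℝ) * ((∏ j, (u j).den : ℕ) : ℝ) * z i ∈
      (Int.castRingHom ℝ).range := by
  set M := restrictedGram A (freeIndices u z)
  set D : ℝ := ((∏ j, (u j).den : ℕ) : ℝ)
  have hD : D ∈ (Int.castRingHom ℝ).range := ⟨(∏ j, (u j).den : ℕ), by simp [D]⟩
  have hMz : ∀ j, D * (M.map (fun a : ℤ => (a : ℝ))).mulVec z j ∈ (Int.castRingHom ℝ).range := by
    intro j
    rw [restrictedGram_map_mulVec, hz.1, Pi.add_apply, mul_add]
    refine add_mem (mul_mem hD ?_) ?_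
    · rw [Matrix.mulVec, dotProduct]
      exact sum_mem fun k _ => mul_mem (intCast_mem _) (intCast_mem _)
    · by_cases hj : j ∈ freeIndices u z
      · simp [hj]
      · rw [Set.indicator_of_mem (show j ∈ (freeIndices u z)ᶜ from hj)]
        rcases (hz.2 j).1.eq_or_lt with h | h
        · simp [← h]
        · rw [le_antisymm (hz.2 j).2 (not_lt.1 fun h' => hj ⟨h, h'⟩)]
          exact prod_den_mul_mem u j
  have hdet : (M.det : ℝ) = (M.map (fun a : ℤ => (a : ℝ))).det :=
    RingHom.map_det (Int.castRingHom ℝ) M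
  have hadj : (M.map (fun a : ℤ => (a : ℝ))).adjugate = M.adjugate.map (fun a : ℤ => (a : ℝ)) :=
    (RingHom.map_adjugate (Int.castRingHom ℝ) M).symm
  have key : (M.det : ℝ) * z i = (M.adjugate.map (fun a : ℤ => (a : ℝ))).mulVec
      ((M.map (fun a : ℤ => (a : ℝ))).mulVec z) i := by
    rw [← hadj, Matrix.mulVec_mulVec, Matrix.adjugate_mul, ← hdet, Matrix.smul_mulVec,
      Matrix.one_mulVec]
    rfl
  rw [mul_right_comm, key, Matrix.mulVec, dotProduct, Finset.sum_mul]
  refine sum_mem fun j _ => ?_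
  rw [mul_assoc, mul_comm _ D]
  exact mul_mem (intCast_mem _) (hMz j)

/-- Distinct objective values of two vertices are not too close. -/
lemma one_le_mul_objective_sub_of_vertices {A : Matrix (Fin d) (Fin n) ℤ} {u : Fin n → ℚ}
    {b : Fin d → ℤ} (c z₀ : Fin n → ℚ) {y z : Fin n → ℝ} (hy : y ∈ lpFeasible A u b)
    (hz : z ∈ lpFeasible A u b) (hdy : (restrictedGram A (freeIndices u y)).det ≠ 0)
    (hdz : (restrictedGram A (freeIndices u z)).det ≠ 0) (hlt : objective c y < objective c z) :
    1 ≤ 2 ^ (2 * inputLength A u b c z₀ + 8 * inputLength A u b c z₀ ^ 2) *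
      (objective c z - objective c y) := by
  set L := inputLength A u b c z₀
  set p := (restrictedGram A (freeIndices u y)).det
  set q := (restrictedGram A (freeIndices u z)).det
  set C := ∏ j, (c j).den
  set D := ∏ j, (u j).den
  have hC : C ≠ 0 := Finset.prod_ne_zero_iff.2 fun j _ => (c j).den_nz
  have hD : D ≠ 0 := Finset.prod_ne_zero_iff.2 fun j _ => (u j).den_nz
  -- `C` clears `c`, `D` clears `u`, and `p`, `q` clear the two vertices. In the bound, `C` and `D`
  -- account for `2 ^ L` each, the determinants for `2 ^ (4 * L ^ 2)` each.
  have hmem : ((C : ℝ) * D * p * q) * (objective c z - objective c y) ∈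
      (Int.castRingHom ℝ).range := by
    have h1 := mul_mem (intCast_mem p) (objective_mem (c := c) (det_mul_prod_den_mul_mem hz))
    have h2 := mul_mem (intCast_mem q) (objective_mem (c := c) (det_mul_prod_den_mul_mem hy))
    convert sub_mem h1 h2 using 1
    simp only [C, D, p, q]
    ring
  have h := one_le_abs_mul (by positivity) (sub_pos.2 hlt) hmem
  refine h.trans (mul_le_mul_of_nonneg_right ?_ (sub_pos.2 hlt).le)
  have hp : |(p : ℝ)| ≤ 2 ^ (4 * L ^ 2) := by
    exact_mod_cast abs_det_restrictedGram_le A u b c z₀ (freeIndices u y)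
  have hq : |(q : ℝ)| ≤ 2 ^ (4 * L ^ 2) := by
    exact_mod_cast abs_det_restrictedGram_le A u b c z₀ (freeIndices u z)
  have hC' : (C : ℝ) ≤ 2 ^ L := by
    exact_mod_cast prod_den_le (sum_ratLength_c_le A u b c z₀)
  have hD' : (D : ℝ) ≤ 2 ^ L := by
    exact_mod_cast prod_den_le (sum_ratLength_u_le A u b c z₀)
  rw [abs_mul, abs_mul, abs_mul, Nat.abs_cast, Nat.abs_cast,
    show 2 * L + 8 * L ^ 2 = L + L + 4 * L ^ 2 + 4 * L ^ 2 by ring, pow_add, pow_add, pow_add]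
  gcongr

/-- Distinct objective values of two integer points are not too close. -/
lemma one_le_mul_objective_sub_of_integral {A : Matrix (Fin d) (Fin n) ℤ} {u : Fin n → ℚ}
    {b : Fin d → ℤ} (c z₀ : Fin n → ℚ) {y z : Fin n → ℝ} (hy : y ∈ ipFeasible A u b)
    (hz : z ∈ ipFeasible A u b) (hlt : objective c y < objective c z) :
    1 ≤ 2 ^ inputLength A u b c z₀ * (objective c z - objective c y) := by
  have hmem : ∀ x ∈ ipFeasible A u b, ((∏ j, (c j).den : ℕ) : ℝ) * 1 * objective c x ∈
      (Int.castRingHom ℝ).range := fun x hx => objective_mem fun i => by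
    obtain ⟨k, hk⟩ := hx.2 i
    rw [hk, one_mul]
    exact intCast_mem k
  have hC : ∏ j, (c j).den ≠ 0 := Finset.prod_ne_zero_iff.2 fun j _ => (c j).den_nz
  have h := one_le_abs_mul (K := ((∏ j, (c j).den : ℕ) : ℝ)) (by exact_mod_cast hC)
    (sub_pos.2 hlt) (by
      have := sub_mem (hmem z hz) (hmem y hy)
      rwa [mul_one, ← mul_sub] at this)
  refine h.trans (mul_le_mul_of_nonneg_right ?_ (sub_pos.2 hlt).le)
  rw [Nat.abs_cast]
  exact_mod_cast prod_den_le (sum_ratLength_c_le A u b c z₀)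

/-! ### Steps inside the feasible region -/

lemma lpFeasible_of_conformal {A : Matrix (Fin d) (Fin n) ℤ} {u : Fin n → ℚ} {b : Fin d → ℤ}
    {y z v : Fin n → ℝ} (hy : y ∈ lpFeasible A u b) (hz : z ∈ lpFeasible A u b)
    (hA : (A.map (fun a : ℤ => (a : ℝ))).mulVec v = 0) (hv : ∀ i, v i ∈ Set.uIcc 0 ((y - z) i)) :
    z + v ∈ lpFeasible A u b := by
  refine ⟨by rw [Matrix.mulVec_add, hA, hz.1, add_zero], fun i => ?_⟩
  have h1 := hy.2 i
  have h2 := hz.2 i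
  have h3 := Set.mem_uIcc.1 (hv i)
  simp only [Pi.sub_apply] at h3
  rw [Pi.add_apply]
  rcases h3 with h3 | h3 <;> constructor <;> linarith

lemma mulVec_sub_eq_zero {A : Matrix (Fin d) (Fin n) ℤ} {u : Fin n → ℚ} {b : Fin d → ℤ}
    {y z : Fin n → ℝ} (hy : y ∈ lpFeasible A u b) (hz : z ∈ lpFeasible A u b) :
    (A.map (fun a : ℤ => (a : ℝ))).mulVec (y - z) = 0 := by
  rw [Matrix.mulVec_sub, hy.1, hz.1, sub_self]

/-- Whenever `y` is better than `z`, some step from `z` along a direction in `S` makes up for at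
least an `N`-th part of the difference. -/
def HasGoodSteps (F : Set (Fin n → ℝ)) (f : (Fin n → ℝ) → ℝ) (S : Set (Fin n → ℝ)) (N : ℕ) :
    Prop :=
  ∀ z ∈ F, ∀ y ∈ F, f y < f z →
    ∃ g ∈ S, ∃ t : ℝ, 0 ≤ t ∧ z + t • g ∈ F ∧ N * (f (z + t • g) - f z) ≤ f y - f z

lemma cast_mul_le_of_le {k N : ℕ} (h : k ≤ N) {v x : ℝ} (hx : x < 0) (hv : k * v ≤ x) :
    N * v ≤ x := by
  have hv0 : v ≤ 0 := by
    by_contra h'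
    push Not at h'
    have : (0 : ℝ) ≤ k * v := by positivity
    linarith
  exact (mul_le_mul_of_nonpos_right (by exact_mod_cast h) hv0).trans hv

theorem hasGoodSteps_circuits (A : Matrix (Fin d) (Fin n) ℤ) (u : Fin n → ℚ) (b : Fin d → ℤ)
    (c : Fin n → ℚ) {N : ℕ} (hN : n ≤ N) :
    HasGoodSteps (lpFeasible A u b) (objective c) (toReal '' circuits A) N := by
  intro z hz y hy hlt
  have hneg : objective c (y - z) < 0 := by rw [objective_sub]; linarith
  obtain ⟨g, hg, t, ht, hti, hav⟩ :=
    exists_isElementary_average c (y - z) (mulVec_sub_eq_zero hy hz) hneg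
  refine ⟨_, ⟨g, mem_circuits_iff.2 hg, rfl⟩, t, ht, lpFeasible_of_conformal hy hz ?_ hti, ?_⟩
  · rw [Matrix.mulVec_smul, map_mulVec_toReal_eq_zero.2 hg.2.1, smul_zero]
  · rw [objective_add, add_sub_cancel_left, ← objective_sub]
    refine cast_mul_le_of_le ?_ hneg hav
    have := Set.ncard_le_card (Function.support (y - z))
    rw [Nat.card_fin] at this
    exact this.trans hN

lemma toReal_sum (a : (Fin n → ℤ) →₀ ℕ) :
    toReal (a.sum fun h k => k • h) = ∑ h ∈ a.support, (a h : ℝ) • toReal h := by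
  ext i
  simp [toReal, Finsupp.sum]

lemma objective_sum {ι : Type*} (c : Fin n → ℚ) (s : Finset ι) (v : ι → Fin n → ℝ) :
    objective c (∑ h ∈ s, v h) = ∑ h ∈ s, objective c (v h) := by
  simp only [objective, Finset.sum_apply, Finset.mul_sum]
  exact Finset.sum_comm

theorem hasGoodSteps_graverBasis (A : Matrix (Fin d) (Fin n) ℤ) (u : Fin n → ℚ) (b : Fin d → ℤ)
    (c : Fin n → ℚ) {N : ℕ} (hN : ∑ i, ratLength (u i) ≤ N) :
    HasGoodSteps (ipFeasible A u b) (objective c) (toReal '' graverBasis A) N := by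
  intro z hz y hy hlt
  obtain ⟨x, hx⟩ : ∃ x : Fin n → ℤ, y - z = toReal x := by
    choose k hk using hy.2
    choose l hl using hz.2
    exact ⟨k - l, by ext i; simp [toReal, hk, hl]⟩
  obtain ⟨s, hs⟩ := exists_signs (toReal x)
  have hker := mulVec_sub_eq_zero hy.1 hz.1
  rw [hx, map_mulVec_toReal_eq_zero] at hker
  have hxs : x ∈ orthantMonoid A s := ⟨hker, fun i => by
    have := hs i
    simp only [toReal] at this
    exact_mod_cast this⟩
  obtain ⟨a, ha, hsum, hcard⟩ := exists_short_decomposition hxs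
  -- Both points lie in the box `[0, u]`, so `|xᵢ| ≤ |uᵢ|` and the product is at most `2 ^ N`.
  have hcard' : a.support.card ≤ N := by
    have h1 : ∏ i, ((x i).natAbs + 1) ≤ 2 ^ ∑ i, ratLength (u i) := by
      rw [← Finset.prod_pow_eq_pow_sum]
      refine Finset.prod_le_prod' fun i _ => ?_
      have h2 := abs_add_one_le_two_pow_ratLength (u i)
      have h3 := congrFun hx i
      have h4 := hy.1.2 i
      have h5 := hz.1.2 i
      have h6 : |(x i : ℝ)| ≤ |(u i : ℝ)| := by
        rw [show (x i : ℝ) = y i - z i from h3.symm]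
        refine (abs_le.2 ⟨?_, ?_⟩).trans (le_abs_self _) <;> linarith
      have h7 : (((x i).natAbs : ℕ) : ℝ) = |(x i : ℝ)| := by
        rw [Nat.cast_natAbs, Int.cast_abs]
      have h8 : (((x i).natAbs : ℕ) : ℝ) + 1 ≤ 2 ^ ratLength (u i) := by linarith
      exact_mod_cast h8
    have h2 := hcard.trans h1
    exact ((Nat.pow_le_pow_iff_right (by norm_num)).1 h2).trans hN
  have hneg : objective c (toReal x) < 0 := by rw [← hx, objective_sub]; linarith
  have hobj : objective c (toReal x) = ∑ h ∈ a.support, objective c ((a h : ℝ) • toReal h) := by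
    rw [← objective_sum, ← toReal_sum, hsum]
  have hne : a.support.Nonempty := by
    by_contra h
    rw [Finset.not_nonempty_iff_eq_empty.1 h, Finset.sum_empty] at hobj
    exact hneg.ne hobj
  obtain ⟨h, hh, hmin⟩ := a.support.exists_min_image
    (fun h => objective c ((a h : ℝ) • toReal h)) hne
  have hav : a.support.card * objective c ((a h : ℝ) • toReal h) ≤ objective c (toReal x) := by
    rw [hobj, ← nsmul_eq_mul]
    exact Finset.card_nsmul_le_sum _ _ _ hmin
  have hmul : (a h : ℝ) • toReal h = toReal (a h • h) := by ext i; simp [toReal]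
  have hahs : a h • h ∈ orthantMonoid A s := AddSubmonoid.nsmul_mem _ (ha h hh).1 _
  -- Both the chosen summand and the rest lie in the orthant of `x`, so the step stays
  -- coordinatewise between `z` and `y`.
  have hrest : x - a h • h ∈ orthantMonoid A s := by
    have : x - a h • h = ∑ h' ∈ a.support.erase h, a h' • h' := by
      rw [sub_eq_iff_eq_add, Finset.sum_erase_add _ _ hh]
      exact hsum.symm
    rw [this]
    exact AddSubmonoid.sum_mem _ fun h' hh' =>
      AddSubmonoid.nsmul_mem _ (ha h' (Finset.mem_of_mem_erase hh')).1 _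
  refine ⟨_, ⟨h, mem_graverBasis_of_mem_indecomposables (ha h hh), rfl⟩, a h, Nat.cast_nonneg _,
    ⟨?_, fun i => ?_⟩, ?_⟩
  · refine lpFeasible_of_conformal hy.1 hz.1 ?_ fun i => ?_
    · rw [hmul, map_mulVec_toReal_eq_zero]
      exact hahs.1
    · have h1 := hahs.2 i
      have h2 := hrest.2 i
      rw [hx, hmul, Set.mem_uIcc]
      simp only [toReal, Pi.sub_apply] at h2 ⊢
      norm_cast
      rcases Int.units_eq_one_or (s i) with h | h <;> simp only [h, Units.val_one,
        Units.val_neg, one_mul, neg_one_mul] at h1 h2 <;> omega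
  · obtain ⟨k, hk⟩ := hz.2 i
    exact ⟨k + (a h • h) i, by rw [hmul]; simp [toReal, hk]⟩
  · rw [objective_add, add_sub_cancel_left, ← objective_sub, hx]
    exact cast_mul_le_of_le hcard' hneg hav

/-- The greedy step is at least as good as the good step. Weakening `N` to `N + 1` permits division
when `N = 0`. -/
lemma IsGreedy.sub_le {F : Set (Fin n → ℝ)} {f : (Fin n → ℝ) → ℝ} {S : Set (Fin n → ℝ)} {N : ℕ}
    (hS : HasGoodSteps F f S N) {y z v : Fin n → ℝ} (hv : IsGreedy F f S z v) (hz : z ∈ F)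
    (hy : y ∈ F) (hlt : f y < f z) : f (z + v) - f y ≤ (1 - 1 / (N + 1)) * (f z - f y) := by
  obtain ⟨g, hg, t, ht, htF, hav⟩ := hS z hz y hy hlt
  have h1 := hv.2.2 t ht g hg htF
  have h2 := cast_mul_le_of_le N.le_succ (by linarith) hav
  push_cast at h2
  have hN : (0 : ℝ) < N + 1 := by positivity
  have h3 : f (z + t • g) - f z ≤ (f y - f z) / (N + 1) := by
    rw [le_div_iff₀ hN]; linarith
  have h4 : (1 - 1 / ((N : ℝ) + 1)) * (f z - f y) = (f z - f y) + (f y - f z) / (N + 1) := by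
    field_simp; ring
  linarith

lemma NoImprovement.isOptimal {F : Set (Fin n → ℝ)} {f : (Fin n → ℝ) → ℝ} {S : Set (Fin n → ℝ)}
    {N : ℕ} (hS : HasGoodSteps F f S N) {z : Fin n → ℝ} (hz : z ∈ F)
    (h : NoImprovement F f S z) : IsOptimal F f z := by
  refine ⟨hz, fun y hy => ?_⟩
  by_contra hlt
  push Not at hlt
  obtain ⟨g, hg, t, ht, htF, hav⟩ := hS z hz y hy hlt
  have h1 := h t ht g hg htF
  have : (0 : ℝ) ≤ N * (f (z + t • g) - f z) := mul_nonneg (Nat.cast_nonneg _) (by linarith)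
  linarith

/-! ### Existence of optimal solutions and of greedy steps -/

lemma continuous_objective (c : Fin n → ℚ) : Continuous (objective c) := by
  unfold objective
  fun_prop

lemma isClosed_lpFeasible (A : Matrix (Fin d) (Fin n) ℤ) (u : Fin n → ℚ) (b : Fin d → ℤ) :
    IsClosed (lpFeasible A u b) := by
  have h1 : Continuous fun z : Fin n → ℝ => (A.map (fun a : ℤ => (a : ℝ))).mulVec z := by
    fun_prop
  have h2 : lpFeasible A u b = {z | (A.map (fun a : ℤ => (a : ℝ))).mulVec z =
      fun j => (b j : ℝ)} ∩ Set.Icc 0 fun i => (u i : ℝ) := by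
    ext z
    simp only [lpFeasible, Set.mem_ofPred_eq, Set.mem_inter_iff, Set.mem_Icc, Pi.le_def,
      Pi.zero_apply, forall_and]
  rw [h2]
  exact (isClosed_eq h1 continuous_const).inter isClosed_Icc

lemma lpFeasible_subset_Icc (A : Matrix (Fin d) (Fin n) ℤ) (u : Fin n → ℚ) (b : Fin d → ℤ) :
    lpFeasible A u b ⊆ Set.Icc 0 fun i => (u i : ℝ) :=
  fun _ hz => ⟨fun i => (hz.2 i).1, fun i => (hz.2 i).2⟩

lemma isCompact_lpFeasible (A : Matrix (Fin d) (Fin n) ℤ) (u : Fin n → ℚ) (b : Fin d → ℤ) :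
    IsCompact (lpFeasible A u b) :=
  isCompact_Icc.of_isClosed_subset (isClosed_lpFeasible A u b) (lpFeasible_subset_Icc A u b)

lemma finite_ipFeasible (A : Matrix (Fin d) (Fin n) ℤ) (u : Fin n → ℚ) (b : Fin d → ℤ) :
    (ipFeasible A u b).Finite := by
  refine ((Set.finite_Icc (0 : Fin n → ℤ) fun i => ⌊u i⌋).image toReal).subset ?_
  intro z hz
  choose k hk using hz.2
  refine ⟨k, ⟨fun i => ?_, fun i => ?_⟩, funext fun i => (hk i).symm⟩
  · have := (hz.1.2 i).1
    rw [hk i] at this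
    exact_mod_cast this
  · have := (hz.1.2 i).2
    rw [hk i] at this
    exact Int.le_floor.2 (by exact_mod_cast this)

/-- The steps along directions from `S` that stay feasible. -/
def feasibleSteps (F : Set (Fin n → ℝ)) (S : Set (Fin n → ℝ)) (z : Fin n → ℝ) :
    Set (Fin n → ℝ) :=
  {v | (∃ α : ℝ, 0 ≤ α ∧ ∃ g ∈ S, v = α • g) ∧ z + v ∈ F}

lemma exists_isGreedy {F : Set (Fin n → ℝ)} {c : Fin n → ℚ} {S : Set (Fin n → ℝ)}
    {z : Fin n → ℝ} (hcomp : IsCompact (feasibleSteps F S z))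
    (h : ¬ NoImprovement F (objective c) S z) :
    ∃ v, IsGreedy F (objective c) S z v ∧ objective c (z + v) < objective c z := by
  unfold NoImprovement at h
  push Not at h
  obtain ⟨α, hα, g, hg, hF, hlt⟩ := h
  obtain ⟨v, hv, hmin⟩ := hcomp.exists_isMinOn ⟨α • g, ⟨α, hα, g, hg, rfl⟩, hF⟩
    (f := fun v => objective c (z + v))
    ((continuous_objective c).comp (continuous_const.add continuous_id)).continuousOn
  have hmin' : ∀ β : ℝ, 0 ≤ β → ∀ g' ∈ S, z + β • g' ∈ F →
      objective c (z + v) ≤ objective c (z + β • g') :=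
    fun β hβ g' hg' hF' => hmin ⟨⟨β, hβ, g', hg', rfl⟩, hF'⟩
  exact ⟨v, ⟨hv.1, hv.2, hmin'⟩, (hmin' α hα g hg hF).trans_lt hlt⟩

lemma isCompact_feasibleSteps_ip (A : Matrix (Fin d) (Fin n) ℤ) (u : Fin n → ℚ) (b : Fin d → ℤ)
    (S : Set (Fin n → ℝ)) (z : Fin n → ℝ) :
    IsCompact (feasibleSteps (ipFeasible A u b) S z) :=
  (((finite_ipFeasible A u b).preimage (add_right_injective z).injOn).subset
    fun _ hv => hv.2).isCompact

/-- There are finitely many circuits, and along each the feasible step lengths form a compact set.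
With `exists_isGreedy` this keeps the procedure from getting stuck. -/
lemma isCompact_feasibleSteps_lp (A : Matrix (Fin d) (Fin n) ℤ) (u : Fin n → ℚ) (b : Fin d → ℤ)
    (z : Fin n → ℝ) :
    IsCompact (feasibleSteps (lpFeasible A u b) (toReal '' circuits A) z) := by
  have hfin : (circuits A).Finite :=
    (finite_setOf_isElementary A).subset fun g hg => mem_circuits_iff.1 hg
  have heq : feasibleSteps (lpFeasible A u b) (toReal '' circuits A) z =
      ⋃ g ∈ circuits A, (fun α : ℝ => α • toReal g) ''
        {α | 0 ≤ α ∧ z + α • toReal g ∈ lpFeasible A u b} := by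
    ext v
    simp only [feasibleSteps, Set.mem_ofPred_eq, Set.mem_iUnion, Set.mem_image, exists_prop]
    constructor
    · rintro ⟨⟨α, hα, _, ⟨g, hg, rfl⟩, rfl⟩, hF⟩
      exact ⟨g, hg, α, ⟨hα, hF⟩, rfl⟩
    · rintro ⟨g, hg, α, ⟨hα, hF⟩, rfl⟩
      exact ⟨⟨α, hα, _, ⟨g, hg, rfl⟩, rfl⟩, hF⟩
  rw [heq]
  refine hfin.isCompact_biUnion fun g hg => ?_
  have hcont : Continuous fun α : ℝ => α • toReal g := by fun_prop
  refine IsCompact.image ?_ hcont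
  -- A nonzero integer coordinate has absolute value at least `1`, so the bounds on that coordinate
  -- bound `α`.
  obtain ⟨i, hi⟩ := Function.ne_iff.1 hg.1
  have hi' : (1 : ℝ) ≤ |(g i : ℝ)| := by exact_mod_cast Int.one_le_abs hi
  refine (isCompact_Icc (a := (0 : ℝ)) (b := |(u i : ℝ)| + |z i|)).of_isClosed_subset ?_ ?_
  · exact (isClosed_le continuous_const continuous_id).inter
      ((isClosed_lpFeasible A u b).preimage (continuous_const.add hcont))
  · rintro α ⟨hα, hF⟩
    refine ⟨hα, ?_⟩
    have h1 := hF.2 i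
    simp only [Pi.add_apply, Pi.smul_apply, smul_eq_mul, toReal] at h1
    have h2 : α ≤ |α * g i| := by
      rw [abs_mul, abs_of_nonneg hα]
      nlinarith
    have h3 := le_abs_self (u i : ℝ)
    have h4 := abs_le.1 (le_refl |z i|)
    refine h2.trans (abs_le.2 ⟨?_, ?_⟩) <;> linarith

/-! ### Support-reducing steps -/

/-- Lexicographic measure of the supports of `z` and of its upper slacks. -/
noncomputable def supportMeasure (u : Fin n → ℚ) (z : Fin n → ℝ) : ℕ :=
  (n + 1) * (Function.support z).ncard + (Function.support fun i => (u i : ℝ) - z i).ncard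

lemma ncard_le_dimension (S : Set (Fin n)) : S.ncard ≤ n := by
  simpa using Set.ncard_le_card S

lemma supportMeasure_le (u : Fin n → ℚ) (z : Fin n → ℝ) : supportMeasure u z ≤ (n + 1) * n + n :=
  Nat.add_le_add (Nat.mul_le_mul_left _ (ncard_le_dimension _)) (ncard_le_dimension _)

/-- The slack term is at most `n`, so losing one element of the support, worth `n + 1`, outweighs
any growth of it. -/
lemma SupportReducing.supportMeasure_lt {u : Fin n → ℚ} {z y : Fin n → ℝ}
    (h : SupportReducing u z y) : supportMeasure u y < supportMeasure u z := by
  unfold supportMeasure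
  rcases h with h | ⟨h1, h2⟩
  · have h3 := Set.ncard_lt_ncard h
    have h4 := ncard_le_dimension (Function.support fun i => (u i : ℝ) - y i)
    nlinarith
  · have h3 := Set.ncard_lt_ncard h2
    rw [h1]
    omega

/-- Ratio test against both bounds. The step is positive because all moving coordinates start
strictly inside. -/
lemma exists_step_to_bound {u z g : Fin n → ℝ} (hz : ∀ i, 0 ≤ z i ∧ z i ≤ u i)
    (hg : ∀ i, g i ≠ 0 → 0 < z i ∧ z i < u i) (hg0 : g ≠ 0) :
    ∃ t : ℝ, 0 < t ∧ (∀ i, 0 ≤ z i + t * g i ∧ z i + t * g i ≤ u i) ∧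
      ∃ i, g i ≠ 0 ∧ (z i + t * g i = 0 ∨ z i + t * g i = u i) := by
  classical
  obtain ⟨j, hj⟩ := Function.ne_iff.1 hg0
  let r : Fin n → ℝ := fun i => if g i < 0 then z i / (-g i) else (u i - z i) / g i
  obtain ⟨k, hk, hmin⟩ := (Finset.univ.filter fun i => g i ≠ 0).exists_min_image r
    ⟨j, by simpa using hj⟩
  simp only [Finset.mem_filter, Finset.mem_univ, true_and] at hk hmin
  have hneg : ∀ i, g i < 0 → r i * (-g i) = z i := fun i hi => by
    simp only [r, if_pos hi]
    exact div_mul_cancel₀ _ (by linarith)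
  have hpos : ∀ i, 0 < g i → r i * g i = u i - z i := fun i hi => by
    simp only [r, if_neg hi.le.not_gt]
    field_simp
  have hr : 0 < r k := by
    have h1 := hg k hk
    rcases lt_or_gt_of_ne hk with h | h
    · have := hneg k h
      nlinarith
    · have := hpos k h
      nlinarith
  refine ⟨r k, hr, fun i => ?_, k, hk, ?_⟩
  · have h1 := hz i
    rcases lt_trichotomy (g i) 0 with h | h | h
    · have h2 := hneg i h
      have h3 := hmin i h.ne
      constructor <;> nlinarith
    · simpa [h] using h1
    · have h2 := hpos i h
      have h3 := hmin i h.ne'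
      constructor <;> nlinarith
  · rcases lt_or_gt_of_ne hk with h | h
    · left
      have := hneg k h
      linarith
    · right
      have := hpos k h
      linarith

/-- From a feasible point that is not a vertex there is a support-reducing circuit step. -/
theorem exists_circuitStep {A : Matrix (Fin d) (Fin n) ℤ} {u : Fin n → ℚ} {b : Fin d → ℤ}
    (c : Fin n → ℚ) {z : Fin n → ℝ} (hz : z ∈ lpFeasible A u b)
    (hdet : (restrictedGram A (freeIndices u z)).det = 0) : ∃ y, CircuitStep A u b c z y := by
  obtain ⟨w, hw0, hw, hws⟩ := exists_kernel_of_det_restrictedGram_eq_zero hdet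
  obtain ⟨g₀, hg₀, hgw⟩ := exists_isElementary_conformal (toReal w)
    (map_mulVec_toReal_eq_zero.2 hw) (fun h => hw0 (toReal_eq_zero.1 h))
  have hg₀s : ∀ i, g₀ i ≠ 0 → i ∈ freeIndices u z := fun i hi => by
    by_contra h
    exact hi ((hgw i).2 (by simp [toReal, hws i h]))
  -- One of the two directions `g₀`, `-g₀` does not increase the objective.
  obtain ⟨g, hg, hgs, hgc⟩ : ∃ g, IsElementary A g ∧ (∀ i, g i ≠ 0 → i ∈ freeIndices u z) ∧
      objective c (toReal g) ≤ 0 := by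
    rcases le_total (objective c (toReal g₀)) 0 with h | h
    · exact ⟨g₀, hg₀, hg₀s, h⟩
    · refine ⟨-g₀, hg₀.neg, fun i hi => hg₀s i (by simpa using hi), ?_⟩
      have : toReal (-g₀) = (-1 : ℝ) • toReal g₀ := by ext i; simp [toReal]
      rw [this, objective_smul]
      linarith
  have hgs' : ∀ i, toReal g i ≠ 0 → 0 < z i ∧ z i < u i := fun i hi =>
    hgs i (by simpa [toReal] using hi)
  obtain ⟨t, ht, htF, i, hi, hbound⟩ := exists_step_to_bound hz.2 hgs'
    (fun h => hg.1.ne_zero (toReal_eq_zero.1 h))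
  have hsub : Function.support (z + t • toReal g) ⊆ Function.support z := fun k hk hzk => by
    by_cases hgk : toReal g k = 0
    · simp [hgk, hzk] at hk
    · exact (hgs' k hgk).1.ne' hzk
  refine ⟨z + t • toReal g, ⟨g, mem_circuits_iff.2 hg, t, ht, rfl⟩, ⟨?_, htF⟩, ?_, ?_⟩
  · rw [Matrix.mulVec_add, Matrix.mulVec_smul, map_mulVec_toReal_eq_zero.2 hg.2.1, smul_zero,
      add_zero, hz.1]
  · rw [objective_add, objective_smul]
    nlinarith
  -- Only free coordinates move, so neither support can grow. A coordinate reaching `0` leaves the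
  -- first; if none does, one reaching its upper bound leaves the second.
  · by_cases hss : Function.support z ⊆ Function.support (z + t • toReal g)
    · refine Or.inr ⟨Set.Subset.antisymm hsub hss, ?_⟩
      refine support_ssubset_of_exists (fun k hk => ?_) ⟨i, ?_, ?_⟩
      · by_cases hgk : toReal g k = 0
        · simpa [hgk] using hk
        · linarith [(hgs' k hgk).2]
      · linarith [(hgs' i hi).2]
      · rcases hbound with h | h
        · exact absurd h (hss (show i ∈ Function.support z from (hgs' i hi).1.ne'))
        · simpa [sub_eq_zero] using h.symm
    · exact Or.inl ⟨hsub, hss⟩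

/-- Every feasible point is dominated by a vertex. -/
lemma exists_vertex_le {A : Matrix (Fin d) (Fin n) ℤ} {u : Fin n → ℚ} {b : Fin d → ℤ}
    (c : Fin n → ℚ) {z : Fin n → ℝ} (hz : z ∈ lpFeasible A u b) :
    ∃ y ∈ lpFeasible A u b, objective c y ≤ objective c z ∧
      (restrictedGram A (freeIndices u y)).det ≠ 0 := by
  induction hk : supportMeasure u z using Nat.strong_induction_on generalizing z with
  | _ k ih =>
    subst hk
    by_cases hdet : (restrictedGram A (freeIndices u z)).det = 0
    · obtain ⟨x, hx⟩ := exists_circuitStep c hz hdet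
      obtain ⟨y, hy, hyx, hdy⟩ := ih _ hx.2.2.2.supportMeasure_lt hx.2.1 rfl
      exact ⟨y, hy, hyx.trans hx.2.2.1, hdy⟩
    · exact ⟨z, hz, le_rfl, hdet⟩

/-! ### Analysis of the procedures -/

lemma run_partial_sums {σ : Type} {step : σ → ℕ → σ → Prop} {s : ℕ → σ} {w : ℕ → ℕ}
    (h : ∀ i, step (s i) (w i) (s (i + 1))) (i : ℕ) :
    Run step (s 0) (∑ j ∈ Finset.range i, w j) (s i) := by
  induction i with
  | zero => exact Run.refl
  | succ i ih =>
    rw [Finset.sum_range_succ]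
    exact ih.snoc (h i)

lemma solvesWithin_of_invariant {step : State n → ℕ → State n → Prop} {F : Set (Fin n → ℝ)}
    {f : (Fin n → ℝ) → ℝ} {z₀ : Fin n → ℝ} {N : ℕ} (I : ℕ → State n → Prop)
    (hinit : I 0 (.greedy z₀)) (hstep : ∀ k s w t, I k s → step s w t → I (k + w) t)
    (hle : ∀ k s, I k s → k ≤ N)
    (hprogress : ∀ k s, I k s → (∃ w t, step s w t) ∨ ∃ z, s = .returned z)
    (hopt : ∀ k z, I k (.returned z) → IsOptimal F f z)
    (hpos : ∀ s w t w' t' w'' t'', step s w t → step t w' t' → step t' w'' t'' →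
      1 ≤ w + w' + w'') :
    SolvesWithin step F f z₀ N := by
  have hI : ∀ k s, Run step (.greedy z₀) k s → I k s := by
    intro k s hr
    induction hr with
    | refl => exact hinit
    | snoc _ hs ih => exact hstep _ _ _ _ ih hs
  refine ⟨fun k s hr => hle k s (hI k s hr), ?_, fun k s hr => hprogress k s (hI k s hr),
    fun k z hr => hopt k z (hI k _ hr)⟩
  rintro ⟨s, w, h0, hs⟩
  -- By `hpos`, every three consecutive transitions contain an augmentation, so an infinite run
  -- would exceed `N` augmentations.
  have hsum : ∀ m, m ≤ ∑ j ∈ Finset.range (3 * m), w j := by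
    intro m
    induction m with
    | zero => simp
    | succ m ih =>
      rw [show 3 * (m + 1) = 3 * m + 1 + 1 + 1 by ring, Finset.sum_range_succ,
        Finset.sum_range_succ, Finset.sum_range_succ]
      have := hpos _ _ _ _ _ _ _ (hs (3 * m)) (hs (3 * m + 1)) (hs (3 * m + 2))
      omega
  have hrun := run_partial_sums hs (3 * (N + 1))
  rw [h0] at hrun
  have h1 := hle _ _ (hI _ _ hrun)
  have h2 := hsum (N + 1)
  omega

lemma one_sub_inv_succ_nonneg (L : ℕ) : 0 ≤ 1 - 1 / ((L : ℝ) + 1) := by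
  have hL : (0 : ℝ) < L + 1 := by positivity
  rw [sub_nonneg, div_le_one hL]
  linarith [Nat.cast_nonneg (α := ℝ) L]

/-- From `1 - t ≤ exp (-t)` and `2 ≤ exp 1`: the hypotheses give `1 ≤ exp (P + Q - m / (L + 1))`. -/
lemma le_of_geometric_decay {L P Q m : ℕ} {x G : ℝ} (hx : 1 ≤ 2 ^ P * x)
    (hxm : x ≤ (1 - 1 / ((L : ℝ) + 1)) ^ m * G) (hG0 : 0 ≤ G) (hG : G ≤ 2 ^ Q) :
    m ≤ (L + 1) * (P + Q) := by
  have hL : (0 : ℝ) < L + 1 := by positivity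
  have h1 : (1 - 1 / ((L : ℝ) + 1)) ^ m ≤ Real.exp (-(m / (L + 1))) := by
    have : 1 - 1 / ((L : ℝ) + 1) ≤ Real.exp (-(1 / (L + 1))) := by
      have := Real.add_one_le_exp (-(1 / ((L : ℝ) + 1)))
      linarith
    refine (pow_le_pow_left₀ (one_sub_inv_succ_nonneg L) this m).trans_eq ?_
    rw [← Real.exp_nat_mul]
    congr 1
    ring
  have h2 : (2 : ℝ) ^ P * 2 ^ Q ≤ Real.exp (P + Q : ℕ) := by
    rw [← pow_add, ← Real.exp_one_pow]
    exact pow_le_pow_left₀ (by norm_num) (by linarith [Real.add_one_le_exp (1 : ℝ)]) _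
  have h3 : 1 ≤ Real.exp ((P + Q : ℕ) - m / (L + 1)) := by
    rw [sub_eq_add_neg, Real.exp_add]
    calc 1 ≤ 2 ^ P * x := hx
      _ ≤ 2 ^ P * (Real.exp (-(m / (L + 1))) * 2 ^ Q) := by
        refine mul_le_mul_of_nonneg_left (hxm.trans ?_) (by positivity)
        exact mul_le_mul h1 hG hG0 (Real.exp_pos _).le
      _ = 2 ^ P * 2 ^ Q * Real.exp (-(m / (L + 1))) := by ring
      _ ≤ _ := mul_le_mul_of_nonneg_right h2 (Real.exp_pos _).le
  have h4 := sub_nonneg.1 (Real.one_le_exp_iff.1 h3)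
  rw [div_le_iff₀ hL] at h4
  have h5 : m ≤ (P + Q) * (L + 1) := by exact_mod_cast h4
  rwa [mul_comm] at h5

/-! ### Bounding the runs of the two procedures. -/

section

variable {A : Matrix (Fin d) (Fin n) ℤ} {u : Fin n → ℚ} {b : Fin d → ℤ} {c : Fin n → ℚ}

/-- Only `back` and `finish` have weight `0`. The only two that can be consecutive are `back` and
then `finish`, after which no transition exists. -/
lemma LPStep.one_le_add {s t t' t'' : State n} {w w' w'' : ℕ} (h : LPStep A u b c s w t)
    (h' : LPStep A u b c t w' t') (h'' : LPStep A u b c t' w'' t'') : 1 ≤ w + w' + w'' := by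
  cases h <;> cases h' <;> first | omega | cases h''

lemma IPStep.one_le_add {s t t' : State n} {w w' : ℕ} (h : IPStep A u b c s w t)
    (h' : IPStep A u b c t w' t') : 1 ≤ w + w' := by
  cases h <;> cases h' <;> omega

end

/-- What holds after `k` augmentation steps of the greedy procedure for the linear program, `y`
being an optimal vertex: some `m ≤ M` of the steps were greedy. -/
def LPInvariant (A : Matrix (Fin d) (Fin n) ℤ) (u : Fin n → ℚ) (b : Fin d → ℤ) (c : Fin n → ℚ)
    (y : Fin n → ℝ) (G : ℝ) (L M B : ℕ) (k : ℕ) : State n → Prop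
  | .greedy z => z ∈ lpFeasible A u b ∧ ∃ m ≤ M, k ≤ m * (B + 1) ∧
      objective c z - objective c y ≤ (1 - 1 / ((L : ℝ) + 1)) ^ m * G ∧
      (m = 0 ∨ (restrictedGram A (freeIndices u z)).det ≠ 0)
  | .reduce z => z ∈ lpFeasible A u b ∧ ∃ m ≤ M, k + supportMeasure u z ≤ m * (B + 1) ∧
      objective c z - objective c y ≤ (1 - 1 / ((L : ℝ) + 1)) ^ m * G
  | .returned z => IsOptimal (lpFeasible A u b) (objective c) z ∧ k ≤ M * (B + 1)

theorem solvesWithin_lp (A : Matrix (Fin d) (Fin n) ℤ) (u : Fin n → ℚ) (b : Fin d → ℤ)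
    (c q : Fin n → ℚ) {z₀ : Fin n → ℝ} (hz₀ : z₀ ∈ lpFeasible A u b) {L : ℕ}
    (hL : inputLength A u b c q = L) :
    SolvesWithin (LPStep A u b c) (lpFeasible A u b) (objective c) z₀
      (((L + 1) * (2 * L + 8 * L ^ 2 + 3 * L) + 1) * ((L + 1) * L + L + 1)) := by
  -- `M` bounds the greedy steps: vertex gaps give `P = 2 * L + 8 * L ^ 2`, the initial gap gives `Q
  -- = 3 * L`, and one more step may close the gap. `B` bounds the reducing steps between two greedy
  -- ones.
  set M := (L + 1) * (2 * L + 8 * L ^ 2 + 3 * L) + 1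
  set B := (L + 1) * L + L
  have hn : n ≤ L := hL ▸ columns_le_inputLength A u b c q
  have hgood := hasGoodSteps_circuits A u b c hn
  obtain ⟨x, hx, hxmin⟩ := (isCompact_lpFeasible A u b).exists_isMinOn ⟨z₀, hz₀⟩
    (continuous_objective c).continuousOn
  -- The lower bound on gaps compares two vertices, so the reference optimum has to be a vertex.
  obtain ⟨y, hy, hyx, hdy⟩ := exists_vertex_le c hx
  have hymin : ∀ z ∈ lpFeasible A u b, objective c y ≤ objective c z :=
    fun z hz => hyx.trans (hxmin hz)
  set G := objective c z₀ - objective c y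
  have hG0 : 0 ≤ G := sub_nonneg.2 (hymin z₀ hz₀)
  have hG : G ≤ 2 ^ (3 * L) := hL ▸ objective_sub_le A u b c q hy hz₀
  have hB : ∀ z : Fin n → ℝ, supportMeasure u z ≤ B := fun z =>
    (supportMeasure_le u z).trans (by simp only [B]; gcongr)
  refine solvesWithin_of_invariant (LPInvariant A u b c y G L M B) ?_ ?_ ?_ ?_ ?_ ?_
  · exact ⟨hz₀, 0, Nat.zero_le _, by simp, by simp [G], Or.inl rfl⟩
  · intro k s w t hI hst
    cases hst with
    | augment z v hgreedy himp =>
      obtain ⟨hz, m, -, hk, hgap, hm⟩ := hI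
      have hlt : objective c y < objective c z := (hymin _ hgreedy.2.1).trans_lt himp
      refine ⟨hgreedy.2.1, m + 1, ?_, ?_, ?_⟩
      -- The start need not be a vertex, so the first greedy step is counted without a gap bound.
      -- Later ones begin where a reduction phase has ended.
      · rcases hm with rfl | hdz
        · simp [M]
        · have h1 := one_le_mul_objective_sub_of_vertices c q hy hz hdy hdz hlt
          rw [hL] at h1
          exact Nat.succ_le_succ (le_of_geometric_decay h1 hgap hG0 hG)
      · have := hB (z + v)
        rw [add_mul]
        omega
      · refine (hgreedy.sub_le hgood hz hy hlt).trans ?_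
        rw [pow_succ', mul_assoc]
        exact mul_le_mul_of_nonneg_left hgap (one_sub_inv_succ_nonneg L)
    | finish z hno =>
      obtain ⟨hz, m, hmM, hk, -⟩ := hI
      exact ⟨hno.isOptimal hgood hz, hk.trans (Nat.mul_le_mul_right _ hmM)⟩
    | reduce z x hcirc =>
      obtain ⟨hz, m, hmM, hk, hgap⟩ := hI
      have := hcirc.2.2.2.supportMeasure_lt
      exact ⟨hcirc.2.1, m, hmM, by omega, by linarith [hcirc.2.2.1]⟩
    | back z hirr =>
      obtain ⟨hz, m, hmM, hk, hgap⟩ := hI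
      -- A point without a reducing circuit step is a vertex.
      refine ⟨hz, m, hmM, by omega, hgap, Or.inr fun h => ?_⟩
      obtain ⟨x, hx⟩ := exists_circuitStep c hz h
      exact hirr x hx
  · intro k s hI
    cases s with
    | greedy z =>
      obtain ⟨-, m, hmM, hk, -⟩ := hI
      exact hk.trans (Nat.mul_le_mul_right _ hmM)
    | reduce z =>
      obtain ⟨-, m, hmM, hk, -⟩ := hI
      exact (Nat.le_of_add_right_le hk).trans (Nat.mul_le_mul_right _ hmM)
    | returned z => exact hI.2
  · intro k s hI
    cases s with
    | greedy z =>
      by_cases h : NoImprovement (lpFeasible A u b) (objective c) (toReal '' circuits A) z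
      · exact Or.inl ⟨_, _, .finish z h⟩
      · obtain ⟨v, hv, hlt⟩ := exists_isGreedy (isCompact_feasibleSteps_lp A u b z) h
        exact Or.inl ⟨_, _, .augment z v hv hlt⟩
    | reduce z =>
      by_cases h : ∃ x, CircuitStep A u b c z x
      · obtain ⟨x, hx⟩ := h
        exact Or.inl ⟨_, _, .reduce z x hx⟩
      · exact Or.inl ⟨_, _, .back z (not_exists.1 h)⟩
    | returned z => exact Or.inr ⟨z, rfl⟩
  · exact fun k z hI => hI.1
  · exact fun s w t w' t' w'' t'' h h' h'' => h.one_le_add h' h''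

/-- What holds after `k` steps of the greedy procedure for the integer program, `y` being an
optimal solution. -/
def IPInvariant (A : Matrix (Fin d) (Fin n) ℤ) (u : Fin n → ℚ) (b : Fin d → ℤ) (c : Fin n → ℚ)
    (y : Fin n → ℝ) (G : ℝ) (L M : ℕ) (k : ℕ) : State n → Prop
  | .greedy z => z ∈ ipFeasible A u b ∧ k ≤ M ∧
      objective c z - objective c y ≤ (1 - 1 / ((L : ℝ) + 1)) ^ k * G
  | .reduce _ => False
  | .returned z => IsOptimal (ipFeasible A u b) (objective c) z ∧ k ≤ M

theorem solvesWithin_ip (A : Matrix (Fin d) (Fin n) ℤ) (u : Fin n → ℚ) (b : Fin d → ℤ)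
    (c q : Fin n → ℚ) {z₀ : Fin n → ℝ} (hz₀ : z₀ ∈ ipFeasible A u b) {L : ℕ}
    (hL : inputLength A u b c q = L) :
    SolvesWithin (IPStep A u b c) (ipFeasible A u b) (objective c) z₀
      ((L + 1) * (L + 3 * L) + 1) := by
  -- Here `P = L` comes from the denominators of `c`, and `Q = 3 * L` from the initial gap. The
  -- extra `1` is for the step that may close the gap.
  set M := (L + 1) * (L + 3 * L) + 1
  have hgood := hasGoodSteps_graverBasis A u b c (hL ▸ sum_ratLength_u_le A u b c q)
  obtain ⟨y, hy, hymin⟩ :=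
    (finite_ipFeasible A u b).exists_minimalFor (objective c) _ ⟨z₀, hz₀⟩
  replace hymin : ∀ z ∈ ipFeasible A u b, objective c y ≤ objective c z :=
    fun z hz => (le_total _ _).elim id fun h => hymin hz h
  set G := objective c z₀ - objective c y
  have hG0 : 0 ≤ G := sub_nonneg.2 (hymin z₀ hz₀)
  have hG : G ≤ 2 ^ (3 * L) := hL ▸ objective_sub_le A u b c q hy.1 hz₀.1
  refine solvesWithin_of_invariant (IPInvariant A u b c y G L M) ?_ ?_ ?_ ?_ ?_ ?_
  · exact ⟨hz₀, Nat.zero_le _, by simp [G]⟩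
  · intro k s w t hI hst
    cases hst with
    | augment z v hgreedy himp =>
      obtain ⟨hz, -, hgap⟩ := hI
      have hlt : objective c y < objective c z := (hymin _ hgreedy.2.1).trans_lt himp
      refine ⟨hgreedy.2.1, ?_, ?_⟩
      · have h1 := one_le_mul_objective_sub_of_integral c q hy hz hlt
        rw [hL] at h1
        exact Nat.succ_le_succ (le_of_geometric_decay h1 hgap hG0 hG)
      · refine (hgreedy.sub_le hgood hz hy hlt).trans ?_
        rw [pow_succ', mul_assoc]
        exact mul_le_mul_of_nonneg_left hgap (one_sub_inv_succ_nonneg L)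
    | finish z hno =>
      obtain ⟨hz, hk, -⟩ := hI
      exact ⟨hno.isOptimal hgood hz, hk⟩
  · intro k s hI
    cases s with
    | greedy z => exact hI.2.1
    | reduce z => exact hI.elim
    | returned z => exact hI.2
  · intro k s hI
    cases s with
    | greedy z =>
      by_cases h : NoImprovement (ipFeasible A u b) (objective c) (toReal '' graverBasis A) z
      · exact Or.inl ⟨_, _, .finish z h⟩
      · obtain ⟨v, hv, hlt⟩ := exists_isGreedy (isCompact_feasibleSteps_ip A u b _ z) h
        exact Or.inl ⟨_, _, .augment z v hv hlt⟩
    | reduce z => exact hI.elim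
    | returned z => exact Or.inr ⟨z, rfl⟩
  · exact fun k z hI => hI.1
  · exact fun s w t w' t' w'' t'' h h' _ => (h.one_le_add h').trans (Nat.le_add_right _ _)

end GreedyAugmentation

open GreedyAugmentation in
theorem theorem1 :
    (∃ P : Polynomial ℕ, ∀ (d n : ℕ) (A : Matrix (Fin d) (Fin n) ℤ) (u : Fin n → ℚ)
        (b : Fin d → ℤ) (c z₀ : Fin n → ℚ),
        (fun i => (z₀ i : ℝ)) ∈ lpFeasible A u b →
        SolvesWithin (LPStep A u b c) (lpFeasible A u b) (objective c) (fun i => (z₀ i : ℝ))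
          (P.eval (inputLength A u b c z₀))) ∧
    (∃ P : Polynomial ℕ, ∀ (d n : ℕ) (A : Matrix (Fin d) (Fin n) ℤ) (u : Fin n → ℚ)
        (b : Fin d → ℤ) (c z₀ : Fin n → ℚ),
        (fun i => (z₀ i : ℝ)) ∈ ipFeasible A u b →
        SolvesWithin (IPStep A u b c) (ipFeasible A u b) (objective c) (fun i => (z₀ i : ℝ))
          (P.eval (inputLength A u b c z₀))) := by
  refine ⟨⟨((Polynomial.X + 1) * (2 * Polynomial.X + 8 * Polynomial.X ^ 2 + 3 * Polynomial.X) + 1) *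
      ((Polynomial.X + 1) * Polynomial.X + Polynomial.X + 1), fun d n A u b c z₀ h => ?_⟩,
    ⟨(Polynomial.X + 1) * (Polynomial.X + 3 * Polynomial.X) + 1, fun d n A u b c z₀ h => ?_⟩⟩
  · simpa using solvesWithin_lp A u b c z₀ h rfl
  · simpa using solvesWithin_ip A u b c z₀ h rfl
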